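/- Let $F$ be a field. Algebras are unital but not necessarily associative. For an $F$-algebra $A$ let $\mathrm{Nuc}(A)$ be its nucleus, i.e. the set of $x\in A$ for which all the associators $(x,a,b)$, $(a,x,b)$, $(a,b,x)$ ($a,b\in A$) vanish, and let $\sigma(A)=\mathrm{Nuc}(A)/\mathrm{Jac}(\mathrm{Nuc}(A))$. A nonzero finite-dimensional $F$-algebra $A$ with center $F$ is semiassociative if there is an étale $F$-subalgebra $K\subseteq\mathrm{Nuc}(A)$ such that $A$ is minimally faithful as a $K\otimes_F K$-module via $(k\otimes k')a=kak'$, i.e. $A$ is faithful and no proper section (quotient of submodules) of $A$ is faithful. The atoms of a semiassociative algebra $A$ are the simple components of the semisimple associative algebra $\sigma(A)$. We say that $A$ is homogeneous if all its atoms are $F$-central and they are all Brauer equivalent to each other. For $n\ge 1$ and scalars $c_{ijk}\in F$ ($1\le i,j,k\le n$) with $c_{iij}=c_{jii}=1$ for all $i,j$, the skew matrix algebra $M_n(F;c)$ is the $F$-algebra with basis $e_{ij}$ ($1\le i,j\le n$) and multiplication $e_{ij}e_{k\ell}=\delta_{jk}c_{ij\ell}e_{i\ell}$. Let $A$ be a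 homogeneous semiassociative $F$-algebra. Then its atoms have an underlying division algebra: there is an associative finite-dimensional $F$-central division algebra $D$ such that every atom of $A$ is isomorphic to a matrix algebra $M_k(D)$ for some $k\ge1$. Moreover, for every associative division $F$-algebra $D$ such that every atom of $A$ is isomorphic to some $M_k(D)$, $k\ge1$, there are $n\ge1$ and a skew matrix algebra $A'=M_n(F;c)$ such that $A\cong D\otimes_F A'$ as $F$-algebras. -/

import Mathlib

open scoped TensorProduct

universe u v w

namespace Semiassociative

/-! Throughout, a (unital, not necessarily associative) algebra `A` over a field `F` is given by
`[NonAssocRing A] [Module F A] [IsScalarTower F A A] [SMulCommClass F A A]`. -/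

section Nucleus

variable (F : Type u) (A : Type v) [Field F] [NonAssocRing A] [Module F A]
  [IsScalarTower F A A] [SMulCommClass F A A]

/-- The nucleus: the elements `x` with `(x, A, A) = (A, x, A) = (A, A, x) = 0`, where
`(x, y, z) = (x * y) * z - x * (y * z)` is the associator. -/
def nucleus : NonUnitalSubalgebra F A where
  carrier := {x | ∀ a b : A, associator x a b = 0 ∧ associator a x b = 0 ∧ associator a b x = 0}
  add_mem' := by
    intro x y hx hy a b
    obtain ⟨hx1, hx2, hx3⟩ := hx a b
    obtain ⟨hy1, hy2, hy3⟩ := hy a b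
    simp only [associator_apply, sub_eq_zero] at *
    simp only [add_mul, mul_add]
    exact ⟨by rw [hx1, hy1], by rw [hx2, hy2], by rw [hx3, hy3]⟩
  zero_mem' := by
    intro a b
    simp [associator_apply]
  mul_mem' := by
    intro x y hx hy a b
    simp only [Set.mem_ofPred_eq, associator_apply, sub_eq_zero] at *
    refine ⟨?_, ?_, ?_⟩
    · rw [(hx y a).1, (hx (y * a) b).1, (hx y (a * b)).1, (hy a b).1]
    · rw [← (hx a y).2.1, (hy (a * x) b).2.1, (hx a (y * b)).2.1, (hx y b).1]
    · rw [← (hy (a * b) x).2.2, (hx a b).2.2, (hy a (b * x)).2.2, (hy b x).2.2]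
  smul_mem' := by
    intro r x hx a b
    simp only [Set.mem_ofPred_eq, associator_apply, sub_eq_zero] at *
    obtain ⟨hx1, hx2, hx3⟩ := hx a b
    simp only [smul_mul_assoc, mul_smul_comm]
    exact ⟨by rw [hx1], by rw [hx2], by rw [hx3]⟩

theorem one_mem_nucleus : (1 : A) ∈ nucleus F A := by
  intro a b
  simp [associator_apply]

/-- The nucleus is an associative unital ring. -/
instance nucleusRing : Ring (nucleus F A) :=
  { (inferInstance : NonUnitalNonAssocRing (nucleus F A)) with
    one := ⟨1, one_mem_nucleus F A⟩
    one_mul := fun x => Subtype.ext (one_mul (x : A))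
    mul_one := fun x => Subtype.ext (mul_one (x : A))
    mul_assoc := fun x y z => Subtype.ext (sub_eq_zero.mp (x.2 (y : A) (z : A)).1) }

instance nucleusAlgebra : Algebra F (nucleus F A) :=
  Algebra.ofModule
    (fun r x y => Subtype.ext (smul_mul_assoc r (x : A) (y : A)))
    (fun r x y => Subtype.ext (mul_smul_comm r (x : A) (y : A)))

/-- The semisimple quotient of the nucleus: the nucleus modulo its Jacobson radical. -/
abbrev SemisimpleQuotient : Type v := nucleus F A ⧸ Ring.jacobson (nucleus F A)

/-- `A` is `F`-central: its center (Mathlib's center of a nonassociative algebra, consisting of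
the nuclear elements commuting with everything) is equal to `F`. -/
def IsCentralAlg : Prop :=
  Nontrivial A ∧
    ∀ z ∈ NonUnitalSubalgebra.center F A, ∃ r : F, z = r • (1 : A)

end Nucleus

section Bimodule

variable {F : Type u} {A : Type v} [Field F] [NonAssocRing A] [Module F A]
  [IsScalarTower F A A] [SMulCommClass F A A]

/-- Left multiplication by nuclear elements. -/
def leftAction : nucleus F A →ₐ[F] Module.End F A :=
  AlgHom.ofLinearMap ((LinearMap.mul F A).comp (nucleus F A).toSubmodule.subtype)
    (by ext a; exact one_mul a)
    (by
      intro x y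
      ext a
      exact sub_eq_zero.mp (x.2 (y : A) a).1)

/-- Right multiplication by the elements of a commutative algebra mapping to the nucleus. -/
def rightAction {K : Type v} [CommRing K] [Algebra F K] (ι : K →ₐ[F] nucleus F A) :
    K →ₐ[F] Module.End F A :=
  AlgHom.ofLinearMap
    ((LinearMap.mul F A).flip.comp ((nucleus F A).toSubmodule.subtype.comp ι.toLinearMap))
    (by
      ext a
      change a * ((ι 1 : nucleus F A) : A) = a
      rw [map_one]
      exact mul_one a)
    (by
      intro x y
      ext a
      change a * ((ι (x * y) : nucleus F A) : A) = (a * (ι y : A)) * (ι x : A)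
      rw [mul_comm x y, map_mul]
      exact (sub_eq_zero.mp ((ι x).2 a (ι y : A)).2.2).symm)

theorem commute_leftAction_rightAction {K : Type v} [CommRing K] [Algebra F K]
    (ι : K →ₐ[F] nucleus F A) (k k' : K) :
    Commute ((leftAction.comp ι) k) (rightAction ι k') := by
  refine LinearMap.ext fun a => ?_
  exact (sub_eq_zero.mp ((ι k).2 a (ι k' : A)).1).symm

/-- For a commutative algebra `K` mapping to the nucleus of `A`, the action of `K ⊗ K` on `A`
given by `(k ⊗ k') a = k a k'`. -/
noncomputable def bimoduleAction {K : Type v} [CommRing K] [Algebra F K]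
    (ι : K →ₐ[F] nucleus F A) : K ⊗[F] K →ₐ[F] Module.End F A :=
  Algebra.TensorProduct.lift (leftAction.comp ι) (rightAction ι)
    (commute_leftAction_rightAction ι)

theorem bimoduleAction_tmul {K : Type v} [CommRing K] [Algebra F K]
    (ι : K →ₐ[F] nucleus F A) (k k' : K) (a : A) :
    bimoduleAction ι (k ⊗ₜ k') a = ((ι k : A) * a) * (ι k' : A) := by
  rw [bimoduleAction, Algebra.TensorProduct.lift_tmul]
  exact (sub_eq_zero.mp ((ι k).2 a (ι k' : A)).1).symm

end Bimodule

/-- A module is minimally faithful if it is faithful and has no proper faithful section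
(a section being a quotient `Q / P` of submodules `P ≤ Q`). -/
def IsMinimallyFaithful (R : Type*) (M : Type*) [Ring R] [AddCommGroup M] [Module R M] : Prop :=
  FaithfulSMul R M ∧
    ∀ P Q : Submodule R M, P ≤ Q → FaithfulSMul R (Q ⧸ P.submoduleOf Q) → P = ⊥ ∧ Q = ⊤

section Classes

variable (F : Type u) (A : Type v) [Field F] [NonAssocRing A] [Module F A]
  [IsScalarTower F A A] [SMulCommClass F A A]

/-- `A` is semiassociative: it is finite dimensional and central over `F`, and minimally faithful
over `K ⊗ K` for some étale subalgebra `K` of the nucleus (given as an étale algebra `K` with an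
embedding into the nucleus). -/
def IsSemiassociative : Prop :=
  FiniteDimensional F A ∧ IsCentralAlg F A ∧
    ∃ (K : Type v) (_ : CommRing K) (_ : Algebra F K) (ι : K →ₐ[F] nucleus F A),
      Algebra.Etale F K ∧ Function.Injective ι ∧
        letI : Module (K ⊗[F] K) A := Module.compHom A (bimoduleAction ι).toRingHom
        IsMinimallyFaithful (K ⊗[F] K) A

/-- The associative algebra `S` is (isomorphic to) a simple component of the semisimple quotient
of the nucleus of `A`, i.e. a simple direct factor of it. -/
def IsAtomOf (S : Type v) [Ring S] [Algebra F S] : Prop :=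
  IsSimpleRing S ∧
    ∃ (T : Type v) (_ : Ring T) (_ : Algebra F T),
      Nonempty (SemisimpleQuotient F A ≃ₐ[F] S × T)

/-- All atoms are `F`-central. -/
def IsSemicentral : Prop :=
  IsSemiassociative F A ∧
    ∀ (S : Type v) [Ring S] [Algebra F S], IsAtomOf F A S → Algebra.IsCentral F S

/-- All atoms are `F`-central (hence central simple) and they are Brauer equivalent to each
other. -/
def IsHomogeneous : Prop :=
  IsSemicentral F A ∧
    ∀ S S' : CSA.{u, v} F, IsAtomOf F A S → IsAtomOf F A S' → IsBrauerEquivalent S S'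

/-- The division algebra `D` underlies the atoms of `A`: every atom is a matrix algebra
over `D`. -/
def IsUnderlyingDivisionAlgebra (D : Type w) [DivisionRing D] [Algebra F D] : Prop :=
  ∀ (S : Type v) [Ring S] [Algebra F S], IsAtomOf F A S →
    ∃ k : ℕ, k ≠ 0 ∧ Nonempty (S ≃ₐ[F] Matrix (Fin k) (Fin k) D)

end Classes

section SkewMatrices

/-- A reduced skew set of degree `n`: scalars `c i j k` with `c i i j = c j i i = 1`. -/
structure ReducedSkewSet (F : Type u) [Field F] (n : ℕ) where
  c : Fin n → Fin n → Fin n → F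
  left_one : ∀ i j, c i i j = 1
  right_one : ∀ i j, c j i i = 1

/-- The skew matrix algebra `Mₙ(F; c)`; as a vector space it is the space of matrices. -/
def SkewMatrix {F : Type u} [Field F] {n : ℕ} (_c : ReducedSkewSet F n) : Type u :=
  Matrix (Fin n) (Fin n) F

namespace SkewMatrix

variable {F : Type u} [Field F] {n : ℕ} (c : ReducedSkewSet F n)

instance : AddCommGroup (SkewMatrix c) :=
  inferInstanceAs (AddCommGroup (Matrix (Fin n) (Fin n) F))

instance : Module F (SkewMatrix c) :=
  inferInstanceAs (Module F (Matrix (Fin n) (Fin n) F))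

instance : Mul (SkewMatrix c) where
  mul x y := fun i l => ∑ j, c.c i j l * (x i j * y j l)

instance : One (SkewMatrix c) where
  one := (1 : Matrix (Fin n) (Fin n) F)

/-- The matrix unit `e_{ij}`. -/
def unit (i j : Fin n) : SkewMatrix c := fun a b => if i = a ∧ j = b then 1 else 0

variable {c}

theorem mul_apply (x y : SkewMatrix c) (i l : Fin n) :
    (x * y) i l = ∑ j, c.c i j l * (x i j * y j l) := rfl

theorem add_apply (x y : SkewMatrix c) (i l : Fin n) : (x + y) i l = x i l + y i l := rfl

theorem zero_apply (i l : Fin n) : (0 : SkewMatrix c) i l = 0 := rfl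

theorem smul_apply (r : F) (x : SkewMatrix c) (i l : Fin n) : (r • x) i l = r * x i l := rfl

theorem one_apply (i l : Fin n) : (1 : SkewMatrix c) i l = if i = l then 1 else 0 :=
  Matrix.one_apply

theorem unit_apply (i j a b : Fin n) :
    unit c i j a b = if i = a ∧ j = b then 1 else 0 := rfl

instance : NonAssocRing (SkewMatrix c) :=
  { (inferInstance : AddCommGroup (SkewMatrix c)),
    (inferInstance : Mul (SkewMatrix c)),
    (inferInstance : One (SkewMatrix c)) with
    left_distrib := by
      intro x y z
      funext i l
      simp only [mul_apply, add_apply, mul_add, Finset.sum_add_distrib]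
    right_distrib := by
      intro x y z
      funext i l
      simp only [mul_apply, add_apply, mul_add, add_mul, Finset.sum_add_distrib]
    zero_mul := by
      intro x
      funext i l
      simp [mul_apply, zero_apply]
    mul_zero := by
      intro x
      funext i l
      simp [mul_apply, zero_apply]
    one_mul := by
      intro x
      funext i l
      simp [mul_apply, one_apply, c.left_one]
    mul_one := by
      intro x
      funext i l
      simp [mul_apply, one_apply, c.right_one] }

instance : IsScalarTower F (SkewMatrix c) (SkewMatrix c) where
  smul_assoc r x y := by
    funext i l
    simp only [smul_eq_mul, mul_apply, smul_apply, Finset.mul_sum]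
    exact Finset.sum_congr rfl fun j _ => by ring

instance : SMulCommClass F (SkewMatrix c) (SkewMatrix c) where
  smul_comm r x y := by
    funext i l
    simp only [smul_eq_mul, mul_apply, smul_apply, Finset.mul_sum]
    exact Finset.sum_congr rfl fun j _ => by ring

/-- The defining multiplication rule `e_{ij} e_{kl} = δ_{jk} c_{ijl} e_{il}`. -/
theorem unit_mul_unit (i j k l : Fin n) :
    unit c i j * unit c k l = if j = k then c.c i j l • unit c i l else 0 := by
  funext a b
  rw [mul_apply]
  split_ifs with h
  · subst h
    rw [smul_apply, unit_apply]
    rw [Finset.sum_eq_single j]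
    · simp only [unit_apply]
      by_cases ha : i = a
      · by_cases hb : l = b
        · subst ha hb
          simp
        · simp [hb]
      · simp [ha]
    · intro m _ hm
      simp [unit_apply, hm.symm]
    · simp
  · rw [zero_apply]
    refine Finset.sum_eq_zero fun m _ => ?_
    by_cases h1 : j = m
    · have : k ≠ m := fun h2 => h (h1.trans h2.symm)
      simp [unit_apply, this]
    · simp [unit_apply, h1]

end SkewMatrix

end SkewMatrices

end Semiassociative

/-! The existence of `D` is Wedderburn's theorem plus uniqueness: Brauer equivalent atoms have
isomorphic matrix algebras over their division algebras, and a matrix algebra determines its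
division algebra (`nonempty_algEquiv_of_matrix`).

For the decomposition, let `K` be the étale subalgebra. As `K ⊗ K` is commutative semisimple,
minimal faithfulness makes `A` isomorphic to `K ⊗ K` as a bimodule
(`exists_cyclic_of_isMinimallyFaithful`). Hence `dim kAk' = dim kK · dim k'K`, and the nucleus,
being a sub-bimodule, is cyclic.

Write σ(A) as a product of central simple algebras `B i`. Cyclicity lifts their central idempotents
to `ε i` in `K`, and gives `(dim Kε i)² ≤ dim (B i)`, because `K ε i` embeds in `B i` and the
enveloping algebra of `B i` acts faithfully. Conversely, the nuclear part of `ε i A ε i` maps onto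
`B i`, and `dim ε i A ε i = (dim Kε i)²`. All these dimensions agree, so the corners of the nucleus
lift σ(A) to a subalgebra, and `dim ε i A ε j` is the geometric mean of `dim (B i)` and `dim (B j)`
(`exists_splitting`).

With `B i = M_{k i}(D)`, the diagonal matrix units cut `A` into nonzero Peirce components of
dimension at most `dim D`. Each is a `D`-bimodule containing a nonzero element `u p q` that
centralizes `D` (`exists_centralizing`), so it equals `D · u p q`. A product `u p q * u q l` again
centralizes `D`, hence is a multiple of `u p l` by a scalar in the center `F` of `D`. These scalars
form the skew set (`exists_equiv_tensor_skewMatrix`). -/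

namespace Semiassociative

/-! ### Enveloping algebras of central simple algebras -/

section CentralSimple

variable (F : Type*) (B : Type*) [Field F] [Ring B] [Algebra F B]

/-- A finite-dimensional central simple algebra acts on itself from both sides as its full
algebra of linear endomorphisms. -/
theorem mulLeftRight_bijective [IsSimpleRing B] [Algebra.IsCentral F B] [FiniteDimensional F B] :
    Function.Bijective (AlgHom.mulLeftRight F B) := by
  have surj : Function.Surjective (AlgHom.mulLeftRight F B) := by
    let _ : Module (B ⊗[F] Bᵐᵒᵖ) B := TensorProduct.Algebra.module
    have smul_def : ∀ (r : B ⊗[F] Bᵐᵒᵖ) (x : B), r • x = AlgHom.mulLeftRight F B r x :=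
      fun _ _ => rfl
    have smul_tmul : ∀ a b x : B, (a ⊗ₜ[F] MulOpposite.op b) • x = a * x * b := fun a b x => by
      rw [smul_def, AlgHom.mulLeftRight_apply]; rfl
    have : IsSimpleModule (B ⊗[F] Bᵐᵒᵖ) B := by
      -- Submodules of `B` over its enveloping algebra are exactly its two-sided ideals.
      refine { eq_bot_or_eq_top := fun M => or_iff_not_imp_left.mpr fun hM => ?_ }
      obtain ⟨x, hx, hx0⟩ := (Submodule.ne_bot_iff M).mp hM
      let I : TwoSidedIdeal B := .mk' M M.zero_mem M.add_mem M.neg_mem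
        (fun {a b} hb => by
          have := M.smul_mem (a ⊗ₜ MulOpposite.op 1) hb
          rwa [smul_tmul, mul_one] at this)
        (fun {a b} ha => by
          have := M.smul_mem (1 ⊗ₜ MulOpposite.op b) ha
          rwa [smul_tmul, one_mul] at this)
      have h1 : (1 : B) ∈ I := IsSimpleRing.one_mem_of_ne_zero_mem I hx0 (by simpa [I] using hx)
      have h1M : (1 : B) ∈ M := by simpa [I] using h1
      exact eq_top_iff.mpr fun y _ => by
        have := M.smul_mem (y ⊗ₜ MulOpposite.op 1) h1M
        rwa [smul_tmul, mul_one, mul_one] at this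
    intro f
    have scalar : ∀ g : Module.End (B ⊗[F] Bᵐᵒᵖ) B, ∃ c : F, ∀ x, g x = c • x := by
      intro g
      have hl : ∀ x, g x = x * g 1 := fun x => by
        have := g.map_smul (x ⊗ₜ MulOpposite.op 1) 1
        rwa [smul_tmul, smul_tmul, mul_one, mul_one, mul_one] at this
      have hr : ∀ x, g x = g 1 * x := fun x => by
        have := g.map_smul (1 ⊗ₜ MulOpposite.op x) 1
        rwa [smul_tmul, smul_tmul, one_mul, one_mul, one_mul] at this
      obtain ⟨c, hc⟩ := (Algebra.IsCentral.mem_center_iff F).mp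
        (Subalgebra.mem_center_iff.mpr fun x => (hl x).symm.trans (hr x))
      exact ⟨c, fun x => by rw [hr, hc, Algebra.smul_def]⟩
    -- The bimodule endomorphisms of `B` are the scalars of `F`, so the density theorem applies to
    -- every `F`-linear `f`; agreement on a finite spanning set is then equality.
    let f' : Module.End (Module.End (B ⊗[F] Bᵐᵒᵖ) B) B :=
      { toFun := f
        map_add' := f.map_add
        map_smul' := fun g x => by
          obtain ⟨c, hc⟩ := scalar g
          simp [Module.End.smul_def, hc] }
    obtain ⟨s, hs⟩ := Module.Finite.fg_top (R := F) (M := B)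
    obtain ⟨r, hr⟩ := jacobson_density f' s
    exact ⟨r, LinearMap.ext_on hs fun x hx => (hr x hx).symm⟩
  refine ⟨?_, surj⟩
  have hd : Module.finrank F (B ⊗[F] Bᵐᵒᵖ) = Module.finrank F (Module.End F B) := by
    rw [Module.finrank_tensorProduct, Module.finrank_linearMap,
      (MulOpposite.opLinearEquiv F : B ≃ₗ[F] Bᵐᵒᵖ).finrank_eq]
  exact (LinearMap.injective_iff_surjective_of_finrank_eq_finrank
    (f := (AlgHom.mulLeftRight F B).toLinearMap) hd).mpr surj

/-- The enveloping algebra of a finite-dimensional central simple algebra is simple. -/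
theorem isSimpleRing_tensor_op [IsSimpleRing B] [Algebra.IsCentral F B] [FiniteDimensional F B] :
    IsSimpleRing (B ⊗[F] Bᵐᵒᵖ) := by
  have : Nonempty (Fin (Module.finrank F B)) := Fin.pos_iff_nonempty.mp Module.finrank_pos
  let e := (AlgEquiv.ofBijective _ (mulLeftRight_bijective F B)).trans
    (algEquivMatrix (Module.finBasis F B))
  exact IsSimpleRing.of_ringEquiv e.symm.toRingEquiv inferInstance

end CentralSimple

/-! ### Two-sided multiplication by nuclear elements -/

section Nuclear

variable {F : Type*} {A : Type*} [Field F] [NonAssocRing A] [Module F A]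
  [IsScalarTower F A A] [SMulCommClass F A A]

theorem nucleus_mul_assoc_left (x : nucleus F A) (a b : A) : (x * a) * b = x * (a * b) :=
  sub_eq_zero.mp (x.2 a b).1

theorem nucleus_mul_assoc_middle (x : nucleus F A) (a b : A) : (a * x) * b = a * (x * b) :=
  sub_eq_zero.mp (x.2 a b).2.1

theorem nucleus_mul_assoc_right (x : nucleus F A) (a b : A) : (a * b) * x = a * (b * x) :=
  sub_eq_zero.mp (x.2 a b).2.2

theorem nucleus_coe_mul (x y : nucleus F A) : ((x * y : nucleus F A) : A) = x * y := rfl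

theorem nucleus_coe_sub (x y : nucleus F A) : ((x - y : nucleus F A) : A) = x - y := rfl

theorem nucleus_coe_sum {ι : Type*} (s : Finset ι) (x : ι → nucleus F A) :
    ((∑ i ∈ s, x i : nucleus F A) : A) = ∑ i ∈ s, (x i : A) :=
  map_sum (nucleus F A).toSubmodule.subtype x s

theorem nucleus_coe_one : ((1 : nucleus F A) : A) = 1 := rfl

/-- Right multiplication by nuclear elements. -/
def rightNuclearAction : (nucleus F A)ᵐᵒᵖ →ₐ[F] Module.End F A :=
  AlgHom.ofLinearMap
    ((LinearMap.mul F A).flip.comp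
      ((nucleus F A).toSubmodule.subtype.comp (MulOpposite.opLinearEquiv F).symm.toLinearMap))
    (by ext a; exact mul_one a)
    (by
      intro x y
      ext a
      exact (nucleus_mul_assoc_right x.unop a y.unop).symm)

theorem commute_leftAction_rightNuclearAction (x : nucleus F A) (y : (nucleus F A)ᵐᵒᵖ) :
    Commute (leftAction x) (rightNuclearAction y) :=
  LinearMap.ext fun a => (nucleus_mul_assoc_left x a y.unop).symm

/-- The map `a ↦ x a y` for nuclear elements `x` and `y`. -/
def sandwich (x y : nucleus F A) : Module.End F A := leftAction x * rightNuclearAction (.op y)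

theorem sandwich_apply (x y : nucleus F A) (a : A) : sandwich x y a = x * (a * y) := rfl

theorem sandwich_mul (x y x' y' : nucleus F A) :
    sandwich x y * sandwich x' y' = sandwich (x * x') (y' * y) := by
  rw [sandwich, sandwich, sandwich, MulOpposite.op_mul, map_mul, map_mul, mul_assoc, mul_assoc,
    ← mul_assoc (rightNuclearAction _) (leftAction _),
    ← (commute_leftAction_rightNuclearAction _ _).eq, mul_assoc]

theorem sandwich_sandwich (x y x' y' : nucleus F A) (a : A) :
    sandwich x y (sandwich x' y' a) = sandwich (x * x') (y' * y) a :=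
  LinearMap.congr_fun (sandwich_mul x y x' y') a

theorem sandwich_one_one : sandwich (1 : nucleus F A) 1 = 1 := by
  rw [sandwich, MulOpposite.op_one, map_one, map_one, one_mul]

theorem sandwich_sum_sum {ι κ : Type*} (s : Finset ι) (t : Finset κ) (x : ι → nucleus F A)
    (y : κ → nucleus F A) :
    sandwich (∑ i ∈ s, x i) (∑ j ∈ t, y j) = ∑ i ∈ s, ∑ j ∈ t, sandwich (x i) (y j) := by
  simp only [sandwich, map_sum, Finset.op_sum, Finset.sum_mul_sum]

end Nuclear

/-! ### Centralizing elements in bimodules -/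

section CentralizingElements

variable {F : Type*} {V : Type*} {D : Type*} [Field F] [AddCommGroup V] [Module F V]
  [Ring D] [IsSimpleRing D] [Algebra F D] [FiniteDimensional F D] [Algebra.IsCentral F D]

/-- A nonzero bimodule over a central simple algebra contains a nonzero centralizing element. The
bimodule is the image of an endomorphism `E` commuting with the two actions. -/
theorem exists_centralizing (l : D →ₐ[F] Module.End F V) (r : Dᵐᵒᵖ →ₐ[F] Module.End F V)
    (hlr : ∀ x y, Commute (l x) (r y)) (E : Module.End F V) (hE : E ≠ 0)
    (hl : ∀ x, Commute (l x) E) (hr : ∀ y, Commute (r y) E) :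
    ∃ a, E a ≠ 0 ∧ ∀ d, l d (E a) = r (.op d) (E a) := by
  obtain ⟨lam, hlam⟩ := (Algebra.linearMap F D).exists_leftInverse_of_injective
    (LinearMap.ker_eq_bot.mpr (FaithfulSMul.algebraMap_injective F D))
  -- `t` acts on `D` as a projection onto the center `F`, so `d ⊗ 1` and `1 ⊗ d` agree on its image.
  -- By faithfulness they agree after multiplication by `t`, and `t` sends any bimodule to
  -- centralizing elements.
  obtain ⟨t, ht⟩ := (mulLeftRight_bijective F D).2 ((Algebra.linearMap F D).comp lam)
  have ht0 : t ≠ 0 := by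
    rintro rfl
    have := LinearMap.congr_fun ht 1
    have h1 : lam 1 = 1 := by simpa using LinearMap.congr_fun hlam 1
    simp [h1] at this
  have htc : ∀ d : D, (d ⊗ₜ 1) * t = (1 ⊗ₜ MulOpposite.op d) * t := fun d => by
    apply (mulLeftRight_bijective F D).1
    rw [map_mul, map_mul, ht]
    ext x
    simpa using (Algebra.commutes (lam x) d).symm
  let Φ : D ⊗[F] Dᵐᵒᵖ →ₐ[F] Module.End F V := Algebra.TensorProduct.lift l r hlr
  have hΦE : ∀ s, Commute (Φ s) E := fun s => by
    induction s with
    | zero => rw [map_zero]; exact Commute.zero_left E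
    | add x y hx hy => rw [map_add]; exact hx.add_left hy
    | tmul x y => rw [Algebra.TensorProduct.lift_tmul]; exact (hl x).mul_left (hr y)
  -- The annihilator of the image of `E` is a two-sided ideal because `E` commutes with the action.
  -- It is proper since `E ≠ 0`, so by simplicity it cannot contain `t`.
  let I : TwoSidedIdeal (D ⊗[F] Dᵐᵒᵖ) := .mk' {s | Φ s * E = 0} (by simp)
    (fun {x y} (hx : _ = 0) (hy : _ = 0) => by simp [add_mul, hx, hy])
    (fun {x} (hx : _ = 0) => by simp [hx])
    (fun {x y} (hy : _ = 0) => by simp [mul_assoc, hy])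
    (fun {x y} (hx : _ = 0) => by
      simp only [Set.mem_ofPred_eq, map_mul, mul_assoc, (hΦE y).eq]
      rw [← mul_assoc, hx, zero_mul])
  have hI : ∀ s, s ∈ I ↔ Φ s * E = 0 := fun s => by simp [I]
  have := isSimpleRing_tensor_op F D
  have htE : E * Φ t ≠ 0 := fun h => hE <| by
    have := IsSimpleRing.one_mem_of_ne_zero_mem I ht0 ((hI t).mpr ((hΦE t).eq.trans h))
    simpa [hI] using this
  obtain ⟨a, ha⟩ : ∃ a, (E * Φ t) a ≠ 0 := by
    by_contra! h
    exact htE (LinearMap.ext h)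
  refine ⟨Φ t a, ha, fun d => ?_⟩
  have h := congrArg (fun s => (Φ s * E) a) (htc d)
  simp only [map_mul, mul_assoc, (hΦE t).eq] at h
  simpa [Φ] using h

end CentralizingElements

/-! ### Recognizing a tensor product with a skew matrix algebra -/

section Recognition

variable {F : Type u} {A : Type v} {D : Type w} [Field F] [NonAssocRing A] [Module F A]
  [IsScalarTower F A A] [SMulCommClass F A A] [DivisionRing D] [Algebra F D]

/-- The map `d ⊗ x ↦ ∑ x_{pq} d u_{pq}`. -/
noncomputable def skewMatrixMap {n : ℕ} (c : ReducedSkewSet F n) (δ : D →ₐ[F] nucleus F A)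
    (u : Fin n → Fin n → A) : D ⊗[F] SkewMatrix c →ₗ[F] A :=
  TensorProduct.lift <| LinearMap.mk₂ F (fun d x => ∑ p, ∑ q, x p q • ((δ d : A) * u p q))
    (fun d d' x => by simp [add_mul, Finset.sum_add_distrib])
    (fun r d x => by
      simp only [map_smul, NonUnitalSubalgebra.coe_smul, smul_mul_assoc, Finset.smul_sum,
        smul_comm r])
    (fun d x y => by simp only [SkewMatrix.add_apply, add_smul, Finset.sum_add_distrib])
    (fun r d x => by simp only [SkewMatrix.smul_apply, mul_smul, Finset.smul_sum])

theorem skewMatrixMap_tmul {n : ℕ} (c : ReducedSkewSet F n) (δ : D →ₐ[F] nucleus F A)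
    (u : Fin n → Fin n → A) (d : D) (x : SkewMatrix c) :
    skewMatrixMap c δ u (d ⊗ₜ x) = ∑ p, ∑ q, x p q • ((δ d : A) * u p q) := rfl

theorem skewMatrixMap_tmul_unit {n : ℕ} (c : ReducedSkewSet F n) (δ : D →ₐ[F] nucleus F A)
    (u : Fin n → Fin n → A) (d : D) (p q : Fin n) :
    skewMatrixMap c δ u (d ⊗ₜ SkewMatrix.unit c p q) = δ d * u p q := by
  rw [skewMatrixMap_tmul, Finset.sum_eq_single p, Finset.sum_eq_single q]
  · simp [SkewMatrix.unit_apply]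
  · intro b _ hb
    simp [SkewMatrix.unit_apply, hb.symm]
  · simp
  · intro b _ hb
    simp [SkewMatrix.unit_apply, hb.symm]
  · simp

theorem SkewMatrix.sum_apply {n : ℕ} {c : ReducedSkewSet F n} {ι : Type*} (s : Finset ι)
    (x : ι → SkewMatrix c) (p q : Fin n) : (∑ i ∈ s, x i) p q = ∑ i ∈ s, x i p q :=
  Matrix.sum_apply p q s x

theorem SkewMatrix.eq_sum_units {n : ℕ} {c : ReducedSkewSet F n} (x : SkewMatrix c) :
    x = ∑ p, ∑ q, x p q • SkewMatrix.unit c p q := by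
  funext a b
  simp only [SkewMatrix.sum_apply, SkewMatrix.smul_apply, SkewMatrix.unit_apply]
  rw [Finset.sum_eq_single a, Finset.sum_eq_single b]
  · simp
  · intro q _ hq
    simp [hq]
  · simp
  · intro p _ hp
    simp [hp]
  · simp

theorem exists_eq_sum_tmul_unit {n : ℕ} {c : ReducedSkewSet F n} (z : D ⊗[F] SkewMatrix c) :
    ∃ d : Fin n → Fin n → D, z = ∑ p, ∑ q, d p q ⊗ₜ SkewMatrix.unit c p q := by
  induction z with
  | zero => exact ⟨0, by simp⟩
  | add x y hx hy =>
    obtain ⟨d, rfl⟩ := hx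
    obtain ⟨d', rfl⟩ := hy
    exact ⟨d + d', by simp [TensorProduct.add_tmul, Finset.sum_add_distrib]⟩
  | tmul d x =>
    refine ⟨fun p q => x p q • d, ?_⟩
    conv_lhs => rw [SkewMatrix.eq_sum_units x]
    simp only [TensorProduct.tmul_sum, TensorProduct.tmul_smul, TensorProduct.smul_tmul']

/-- It suffices to compare on the elements `d ⊗ e_{pq}`. There the nuclear coefficients reassociate
freely and move past the `u p q`, which they centralize, so only the products of the `u p q` remain.
-/
theorem skewMatrixMap_mul {n : ℕ} (c : ReducedSkewSet F n) (δ : D →ₐ[F] nucleus F A)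
    (u : Fin n → Fin n → A) (huc : ∀ p q d, (δ d : A) * u p q = u p q * δ d)
    (huu : ∀ p q q' l, u p q * u q' l = if q = q' then c.c p q l • u p l else 0) :
    ∀ x y, skewMatrixMap c δ u (x * y) = skewMatrixMap c δ u x * skewMatrixMap c δ u y := by
  have hbasis : ∀ d d' p q q' l,
      skewMatrixMap c δ u ((d ⊗ₜ SkewMatrix.unit c p q) * (d' ⊗ₜ SkewMatrix.unit c q' l)) =
      skewMatrixMap c δ u (d ⊗ₜ SkewMatrix.unit c p q) *
        skewMatrixMap c δ u (d' ⊗ₜ SkewMatrix.unit c q' l) := by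
    intro d d' p q q' l
    simp only [skewMatrixMap_tmul_unit]
    rw [nucleus_mul_assoc_left, ← nucleus_mul_assoc_middle, ← huc, nucleus_mul_assoc_left, huu,
      ← nucleus_mul_assoc_left, ← nucleus_coe_mul, ← map_mul, Algebra.TensorProduct.tmul_mul_tmul,
      SkewMatrix.unit_mul_unit]
    split_ifs with h
    · rw [TensorProduct.tmul_smul, map_smul, skewMatrixMap_tmul_unit, mul_smul_comm]
    · rw [TensorProduct.tmul_zero, map_zero, mul_zero]
  intro x y
  obtain ⟨d, rfl⟩ := exists_eq_sum_tmul_unit x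
  obtain ⟨d', rfl⟩ := exists_eq_sum_tmul_unit y
  simp only [Finset.sum_mul, Finset.mul_sum, map_sum, hbasis]

theorem skewMatrixMap_one {n : ℕ} (c : ReducedSkewSet F n) (δ : D →ₐ[F] nucleus F A)
    (u : Fin n → Fin n → A) (f : Fin n → nucleus F A) (hdiag : ∀ p, u p p = f p)
    (hf : ∑ p, f p = 1) : skewMatrixMap c δ u 1 = 1 := by
  have hone : (1 : A) = ∑ p, (f p : A) := by
    rw [← nucleus_coe_one (F := F), ← hf, nucleus_coe_sum]
  rw [Algebra.TensorProduct.one_def, skewMatrixMap_tmul, map_one, nucleus_coe_one]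
  refine Eq.trans ?_ hone.symm
  refine Finset.sum_congr rfl fun p _ => ?_
  rw [Finset.sum_eq_single p]
  · rw [SkewMatrix.one_apply, if_pos rfl, one_smul, hdiag, one_mul]
  · intro q _ hq
    rw [SkewMatrix.one_apply, if_neg hq.symm, zero_smul]
  · simp

/-- An algebra containing a central division algebra `D` in its nucleus, together with a complete
system of nuclear idempotents centralizing `D` for which every Peirce component is nonzero and
at most as large as `D`, is the tensor product of `D` and a skew matrix algebra. -/
theorem exists_equiv_tensor_skewMatrix [FiniteDimensional F D] [Algebra.IsCentral F D]
    [FiniteDimensional F A] {n : ℕ} (δ : D →ₐ[F] nucleus F A) (f : Fin n → nucleus F A)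
    (hf : CompleteOrthogonalIdempotents f) (hcomm : ∀ d p, Commute (δ d) (f p))
    (hne : ∀ p q, sandwich (f p) (f q) ≠ 0)
    (hdim : ∀ p q, Module.finrank F (LinearMap.range (sandwich (f p) (f q))) ≤
      Module.finrank F D) :
    ∃ (c : ReducedSkewSet F n) (e : A ≃ₗ[F] D ⊗[F] SkewMatrix c),
      e 1 = 1 ∧ ∀ x y : A, e (x * y) = e x * e y := by
  have hff : ∀ p, f p * f p = f p := hf.idem
  have hfo : ∀ p q, p ≠ q → f p * f q = 0 := fun p q h => hf.ortho h
  -- On the diagonal the centralizing element is taken to be the idempotent itself; this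
  -- normalization makes the skew set reduced.
  have key : ∀ p q, ∃ u : A, (p = q → u = f p) ∧ u ≠ 0 ∧ sandwich (f p) (f q) u = u ∧
      ∀ d, (δ d : A) * u = u * δ d := by
    intro p q
    by_cases hpq : p = q
    · subst hpq
      refine ⟨f p, fun _ => rfl, fun h => hne p p ?_, ?_, fun d => ?_⟩
      · ext a
        simp [sandwich_apply, h]
      · simp only [sandwich_apply, ← nucleus_coe_mul, hff]
      · simp only [← nucleus_coe_mul, (hcomm d p).eq]
    · obtain ⟨a, ha, hc⟩ := exists_centralizing (leftAction.comp δ)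
        (rightNuclearAction.comp δ.op) (fun x y => commute_leftAction_rightNuclearAction _ _)
        (sandwich (f p) (f q)) (hne p q)
        (fun x => ((hcomm x p).map leftAction).mul_right
          (commute_leftAction_rightNuclearAction _ _))
        (fun y => (commute_leftAction_rightNuclearAction _ _).symm.mul_right
          (((hcomm y.unop q).op).map rightNuclearAction))
      refine ⟨_, fun h => absurd h hpq, ha, ?_, hc⟩
      rw [sandwich_sandwich, hff, hff]
  choose u hdiag hu0 hu huc using key
  have huleft : ∀ p q, (f p : A) * u p q = u p q := fun p q => by
    rw [← hu p q, sandwich_apply, ← nucleus_mul_assoc_left (f p), ← nucleus_coe_mul, hff]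
  have huright : ∀ p q, u p q * (f q : A) = u p q := fun p q => by
    rw [← hu p q, sandwich_apply, nucleus_mul_assoc_right, nucleus_mul_assoc_right,
      ← nucleus_coe_mul, hff]
  have hδ0 : ∀ p q d, (δ d : A) * u p q = 0 → d = 0 := by
    intro p q d h
    by_contra hd
    apply hu0 p q
    rw [← one_mul (u p q), ← nucleus_coe_one (F := F), ← map_one δ, ← inv_mul_cancel₀ hd, map_mul,
      nucleus_coe_mul, nucleus_mul_assoc_left, h, mul_zero]
  have hsand : ∀ p q p' q' d, sandwich (f p) (f q) (δ d * u p' q') =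
      if p = p' ∧ q = q' then (δ d : A) * u p' q' else 0 := by
    intro p q p' q' d
    have hfu : (f p : A) * u p' q' = if p = p' then u p' q' else 0 := by
      split_ifs with h
      · rw [h, huleft]
      · rw [← huleft p' q', ← nucleus_mul_assoc_left, ← nucleus_coe_mul, hfo p p' h]
        simp
    have huf : u p' q' * (f q : A) = if q = q' then u p' q' else 0 := by
      split_ifs with h
      · rw [h, huright]
      · rw [← huright p' q', nucleus_mul_assoc_right, ← nucleus_coe_mul, hfo q' q (Ne.symm h)]
        simp
    rw [sandwich_apply, nucleus_mul_assoc_left, huf]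
    by_cases hq : q = q'
    · rw [if_pos hq, ← nucleus_mul_assoc_left, ← nucleus_coe_mul, ← (hcomm d p).eq,
        nucleus_coe_mul, nucleus_mul_assoc_left, hfu]
      by_cases hp : p = p' <;> simp [hp, hq]
    · simp [hq]
  have hspan : ∀ p q a, ∃ d, sandwich (f p) (f q) a = δ d * u p q := by
    intro p q a
    -- The map `d ↦ d u` from `D` to the Peirce component is injective, and the bound `hdim` forces
    -- it to be onto.
    let g : D →ₗ[F] LinearMap.range (sandwich (f p) (f q)) :=
      { toFun := fun d => ⟨δ d * u p q, _, (hsand p q p q d).trans (if_pos ⟨rfl, rfl⟩)⟩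
        map_add' := fun d d' => Subtype.ext (by simp [add_mul])
        map_smul' := fun r d => Subtype.ext (by simp [smul_mul_assoc]) }
    have hg : Function.Injective g := (injective_iff_map_eq_zero g).mpr fun d hd =>
      hδ0 p q d (congrArg Subtype.val hd)
    obtain ⟨d, hd⟩ := (LinearMap.injective_iff_surjective_of_finrank_eq_finrank
      (le_antisymm (LinearMap.finrank_le_finrank_of_injective hg) (hdim p q))).mp hg
      ⟨_, a, rfl⟩
    exact ⟨d, (congrArg Subtype.val hd).symm⟩
  have hscalar : ∀ p q l, ∃ r : F, u p q * u q l = r • u p l := by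
    intro p q l
    have h1 : sandwich (f p) (f l) (u p q * u q l) = u p q * u q l := by
      rw [sandwich_apply, nucleus_mul_assoc_right, huright, ← nucleus_mul_assoc_left, huleft]
    obtain ⟨d, hd⟩ := hspan p l (u p q * u q l)
    rw [h1] at hd
    -- Both `u p q * u q l = d u p l` and `u p l` centralize `D`, so `(x d - d x) u p l = 0`. Thus
    -- `d` is central in `D`, hence a scalar.
    have hdc : ∀ x, x * d = d * x := fun x => by
      refine sub_eq_zero.mp (hδ0 p l _ ?_)
      rw [map_sub, map_mul, map_mul, nucleus_coe_sub, nucleus_coe_mul,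
        nucleus_coe_mul, sub_mul, nucleus_mul_assoc_left, nucleus_mul_assoc_left, ← hd,
        ← nucleus_mul_assoc_left, huc, nucleus_mul_assoc_middle, huc q l, huc p l,
        ← nucleus_mul_assoc_left, ← hd, nucleus_mul_assoc_right, sub_self]
    obtain ⟨r, hr⟩ := (Algebra.IsCentral.mem_center_iff F).mp (Subalgebra.mem_center_iff.mpr hdc)
    refine ⟨r, ?_⟩
    rw [hd, hr, Algebra.algebraMap_eq_smul_one, map_smul, map_one]
    simp [nucleus_coe_one]
  choose c hc using hscalar
  let C : ReducedSkewSet F n :=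
    { c := c
      left_one := fun i j => by
        have h := hc i i j
        rw [hdiag i i rfl, huleft] at h
        exact (smul_left_injective F (hu0 i j) (h.symm.trans (one_smul F _).symm))
      right_one := fun i j => by
        have h := hc j i i
        rw [hdiag i i rfl, huright] at h
        exact (smul_left_injective F (hu0 j i) (h.symm.trans (one_smul F _).symm)) }
  let T := skewMatrixMap C δ u
  have hTsurj : Function.Surjective T := by
    intro a
    choose d hd using fun p q => hspan p q a
    refine ⟨∑ p, ∑ q, d p q ⊗ₜ SkewMatrix.unit C p q, ?_⟩
    simp only [map_sum, T, skewMatrixMap_tmul_unit, ← hd]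
    -- Peirce decomposition of `a`: expand `1 * a * 1` with `1 = ∑ f p`.
    have h := sandwich_sum_sum Finset.univ Finset.univ f f
    rw [hf.complete, sandwich_one_one] at h
    simpa using (LinearMap.congr_fun h a).symm
  have hTinj : Function.Injective T := (injective_iff_map_eq_zero T).mpr fun z hz => by
    obtain ⟨d, rfl⟩ := exists_eq_sum_tmul_unit z
    have hd : ∀ p q, d p q = 0 := fun p q => by
      refine hδ0 p q _ ?_
      have h := congrArg (sandwich (f p) (f q)) hz
      simp only [map_sum, T, skewMatrixMap_tmul_unit, hsand, map_zero] at h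
      rwa [Finset.sum_eq_single p, Finset.sum_eq_single q, if_pos ⟨rfl, rfl⟩] at h
      · exact fun b _ hb => if_neg fun h => hb h.2.symm
      · simp
      · exact fun b _ hb => Finset.sum_eq_zero fun _ _ => if_neg fun h => hb h.1.symm
      · simp
    simp [hd]
  have huu : ∀ p q q' l, u p q * u q' l = if q = q' then c p q l • u p l else 0 := by
    intro p q q' l
    split_ifs with h
    · subst h
      exact hc p q l
    · rw [← huright p q, ← huleft q' l, nucleus_mul_assoc_middle, ← nucleus_mul_assoc_left,
        ← nucleus_coe_mul, hfo q q' h]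
      simp
  have hTmul := skewMatrixMap_mul C δ u huc huu
  have hTone := skewMatrixMap_one C δ u f (fun p => hdiag p p rfl) hf.complete
  let e := (LinearEquiv.ofBijective T ⟨hTinj, hTsurj⟩).symm
  have he : ∀ a, T (e a) = a := (LinearEquiv.ofBijective T ⟨hTinj, hTsurj⟩).apply_symm_apply
  exact ⟨C, e, hTinj (by rw [he, hTone]), fun x y => hTinj (by rw [he, hTmul, he, he])⟩

end Recognition

/-! ### Factorizations and ranks of linear maps -/

section LinearAlgebra

variable {F V W U V' W' : Type*} [Field F] [AddCommGroup V] [Module F V] [AddCommGroup W]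
  [Module F W] [AddCommGroup U] [Module F U] [AddCommGroup V'] [Module F V'] [AddCommGroup W']
  [Module F W']

theorem exists_comp_eq_of_ker_le_ker (g : V →ₗ[F] W) (m : V →ₗ[F] U)
    (h : LinearMap.ker g ≤ LinearMap.ker m) : ∃ k : W →ₗ[F] U, k.comp g = m := by
  obtain ⟨k, hk⟩ := LinearMap.exists_extend
    (((LinearMap.ker g).liftQ m h).comp g.quotKerEquivRange.symm.toLinearMap)
  refine ⟨k, LinearMap.ext fun x => ?_⟩
  have hx := LinearMap.congr_fun hk (g.quotKerEquivRange (Submodule.Quotient.mk x))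
  simpa using hx

theorem finrank_range_le_of_ker_le_ker [FiniteDimensional F W] (g : V →ₗ[F] W) (m : V →ₗ[F] U)
    (h : LinearMap.ker g ≤ LinearMap.ker m) :
    Module.finrank F (LinearMap.range m) ≤ Module.finrank F W := by
  obtain ⟨k, rfl⟩ := exists_comp_eq_of_ker_le_ker g m h
  exact (Submodule.finrank_mono (LinearMap.range_comp_le_range g k)).trans
    (LinearMap.finrank_range_le k)

theorem finrank_range_tensorMap (f : V →ₗ[F] W) (g : V' →ₗ[F] W') :
    Module.finrank F (LinearMap.range (TensorProduct.map f g)) =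
      Module.finrank F (LinearMap.range f) * Module.finrank F (LinearMap.range g) := by
  have h : LinearMap.range (TensorProduct.map f g) =
      LinearMap.range (TensorProduct.mapIncl (LinearMap.range f) (LinearMap.range g)) := by
    rw [TensorProduct.range_map, TensorProduct.range_mapIncl]
  rw [h, LinearMap.finrank_range_of_inj, Module.finrank_tensorProduct]
  exact Module.Flat.tensorProduct_mapIncl_injective_of_left _ _

end LinearAlgebra

/-! ### Cyclic `K`-bimodules -/

section Bimodules

variable {F K B C : Type*} [Field F] [CommRing K] [Algebra F K] [Ring B] [Algebra F B]
  [Ring C] [Algebra F C]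

/-- For a commutative algebra `K` mapping to an associative algebra `B`, the action of `K ⊗ K` on
`B` given by `(k ⊗ k') b = k b k'`. -/
noncomputable def bimoduleEnd (g : K →ₐ[F] B) : K ⊗[F] K →ₐ[F] Module.End F B :=
  (AlgHom.mulLeftRight F B).comp
    (Algebra.TensorProduct.map g (g.op.comp (AlgEquiv.toOpposite F K).toAlgHom))

theorem bimoduleEnd_tmul (g : K →ₐ[F] B) (k k' : K) (b : B) :
    bimoduleEnd g (k ⊗ₜ k') b = g k * b * g k' := by
  simp [bimoduleEnd]

theorem map_bimoduleEnd (p : B →ₐ[F] C) (g : K →ₐ[F] B) (r : K ⊗[F] K) (b : B) :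
    p (bimoduleEnd g r b) = bimoduleEnd (p.comp g) r (p b) := by
  induction r with
  | zero => simp
  | add x y hx hy => simp [hx, hy]
  | tmul x y => simp [bimoduleEnd_tmul]

/-- Evaluation at `1` turns an operator coming from `K ⊗ K` into an element of the image of `K`. -/
theorem bimoduleEnd_one (g : K →ₐ[F] B) (r : K ⊗[F] K) :
    bimoduleEnd g r 1 = g (Algebra.TensorProduct.lmul' F r) := by
  induction r with
  | zero => simp
  | add x y hx hy => simp [hx, hy]
  | tmul x y => simp [bimoduleEnd_tmul]

theorem bimoduleEnd_mul_of_commute (g : K →ₐ[F] B) (c : B) (hc : ∀ k, Commute c (g k))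
    (r : K ⊗[F] K) (b : B) : bimoduleEnd g r (c * b) = c * bimoduleEnd g r b := by
  induction r with
  | zero => simp
  | add x y hx hy => simp [hx, hy, mul_add]
  | tmul x y => simp only [bimoduleEnd_tmul, ← mul_assoc, (hc x).eq]

/-- Since the enveloping algebra of `B` acts faithfully, `r` already dies in `B ⊗ Bᵐᵒᵖ`; and `m ⊗ m`
factors through that map because `m` factors through `g`. -/
theorem map_eq_zero_of_bimoduleEnd_eq_zero [IsSimpleRing B] [Algebra.IsCentral F B]
    [FiniteDimensional F B] (g : K →ₐ[F] B) (m : K →ₗ[F] K)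
    (h : LinearMap.ker g.toLinearMap ≤ LinearMap.ker m) (r : K ⊗[F] K)
    (hr : bimoduleEnd g r = 0) : TensorProduct.map m m r = 0 := by
  obtain ⟨k, rfl⟩ := exists_comp_eq_of_ker_le_ker _ _ h
  have h0 : Algebra.TensorProduct.map g (g.op.comp (AlgEquiv.toOpposite F K).toAlgHom) r = 0 :=
    (mulLeftRight_bijective F B).1 (by rw [map_zero]; exact hr)
  have h1 : TensorProduct.map (k.comp g.toLinearMap) (k.comp g.toLinearMap) r =
      TensorProduct.map k (k.comp (MulOpposite.opLinearEquiv F).symm.toLinearMap)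
        (Algebra.TensorProduct.map g (g.op.comp (AlgEquiv.toOpposite F K).toAlgHom) r) := by
    clear hr h0
    induction r with
    | zero => simp
    | add x y hx hy => simp only [map_add, hx, hy]
    | tmul x y => simp
  rw [h1, h0, map_zero]

/-- If a `K`-bimodule generated by one element is a central simple algebra containing an ideal
of `K`, then its dimension is at least the square of the dimension of that ideal. -/
theorem sq_finrank_le_of_bimodule_cyclic [IsSimpleRing B] [Algebra.IsCentral F B]
    [FiniteDimensional F B] (g : K →ₐ[F] B) (m : K →ₗ[F] K)
    (h : LinearMap.ker g.toLinearMap ≤ LinearMap.ker m) (b₀ : B)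
    (hb₀ : ∀ b, ∃ r, bimoduleEnd g r b₀ = b) :
    Module.finrank F (LinearMap.range m) * Module.finrank F (LinearMap.range m) ≤
      Module.finrank F B := by
  rw [← finrank_range_tensorMap]
  refine finrank_range_le_of_ker_le_ker
    ((LinearMap.applyₗ b₀).comp (bimoduleEnd g).toLinearMap) _ fun r hr => ?_
  have hr0 : bimoduleEnd g r b₀ = 0 := hr
  -- As `K ⊗ K` is commutative, whatever kills the generator kills all of `B`.
  refine map_eq_zero_of_bimoduleEnd_eq_zero g m h r (LinearMap.ext fun b => ?_)
  obtain ⟨s, rfl⟩ := hb₀ b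
  rw [← Module.End.mul_apply, ← map_mul, mul_comm, map_mul, Module.End.mul_apply, hr0, map_zero,
    LinearMap.zero_apply]

/-- If a product of algebras is generated by one element as a `K`-bimodule, then `K` contains its
central idempotents. -/
theorem exists_map_eq_single {I : Type*} [DecidableEq I] {B : I → Type*} [∀ i, Ring (B i)]
    [∀ i, Algebra F (B i)] (q : K →ₐ[F] ∀ i, B i) (b₀ : ∀ i, B i)
    (hb₀ : ∀ b, ∃ r, bimoduleEnd q r b₀ = b) (i : I) : ∃ k, q k = Pi.single i 1 := by
  set c : ∀ i, B i := Pi.single i 1 with hc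
  have hcomm : ∀ b, Commute c b := fun b => by
    funext j
    by_cases hj : j = i
    · subst hj
      simp [hc]
    · simp [hc, hj]
  -- Multiplication by the central `c` is an endomorphism of a cyclic module over the commutative
  -- ring `K ⊗ K`, hence is the action of some `r`. Applied to `1`, it exhibits `c` as an element of
  -- the image of `K`.
  obtain ⟨r, hr⟩ := hb₀ (c * b₀)
  have h : ∀ b, bimoduleEnd q r b = c * b := fun b => by
    obtain ⟨s, rfl⟩ := hb₀ b
    rw [← Module.End.mul_apply, ← map_mul, mul_comm, map_mul, Module.End.mul_apply, hr,
      bimoduleEnd_mul_of_commute q c fun k => hcomm _]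
  exact ⟨Algebra.TensorProduct.lmul' F r, by rw [← bimoduleEnd_one, h, mul_one]⟩

end Bimodules

/-! ### Lifting the semisimple quotient into the nucleus -/

section Splitting

variable {F A K : Type*} [Field F] [NonAssocRing A] [Module F A] [IsScalarTower F A A]
  [SMulCommClass F A A] [FiniteDimensional F A] [CommRing K] [Algebra F K] [IsReduced K]

/-- If `A` looks like `K ⊗ K` as a `K`-bimodule, and `p` is a surjection with nil kernel from the
nucleus of `A` to a product of central simple algebras, then `p` splits, and the dimensions of
the Peirce components of `A` are determined by the dimensions of the factors. -/
theorem exists_splitting (ι : K →ₐ[F] nucleus F A) (hι : Function.Injective ι)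
    (m₀ : nucleus F A) (hm₀ : ∀ x, ∃ r, bimoduleEnd ι r m₀ = x)
    (hrank : ∀ k k', Module.finrank F (LinearMap.range (sandwich (ι k) (ι k'))) =
      Module.finrank F (LinearMap.range (LinearMap.mulLeft F k)) *
        Module.finrank F (LinearMap.range (LinearMap.mulLeft F k')))
    {I : Type*} [Fintype I] [DecidableEq I] {B : I → Type*} [∀ i, Ring (B i)]
    [∀ i, Algebra F (B i)] [∀ i, IsSimpleRing (B i)] [∀ i, Algebra.IsCentral F (B i)]
    [∀ i, FiniteDimensional F (B i)] (p : nucleus F A →ₐ[F] ∀ i, B i)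
    (hp : Function.Surjective p) (hnil : ∀ x, p x = 0 → IsNilpotent x) :
    ∃ ψ : (∀ i, B i) →ₐ[F] nucleus F A, ∀ i j,
      Module.finrank F (LinearMap.range (sandwich (ψ (Pi.single i 1)) (ψ (Pi.single j 1)))) ^ 2 =
        Module.finrank F (B i) * Module.finrank F (B j) := by
  have : FiniteDimensional F (nucleus F A) :=
    inferInstanceAs (FiniteDimensional F (nucleus F A).toSubmodule)
  have hq : Function.Injective (p.comp ι) := (injective_iff_map_eq_zero _).mpr fun k hk => by
    obtain ⟨n, hn⟩ := hnil (ι k) hk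
    exact IsReduced.eq_zero k ⟨n, hι (by rw [map_pow, hn, map_zero])⟩
  have hcyc : ∀ b, ∃ r, bimoduleEnd (p.comp ι) r (p m₀) = b := fun b => by
    obtain ⟨x, rfl⟩ := hp b
    obtain ⟨r, rfl⟩ := hm₀ x
    exact ⟨r, (map_bimoduleEnd p ι r m₀).symm⟩
  choose ε hε using exists_map_eq_single (p.comp ι) (p m₀) hcyc
  have hεp : ∀ i, p (ι (ε i)) = Pi.single i 1 := hε
  have hsum : ∑ i, ι (ε i) = 1 := by
    rw [← map_sum, ← map_one ι]
    congr 1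
    apply hq
    rw [map_sum, map_one]
    simp only [hε]
    exact Finset.univ_sum_single 1
  have hcyci : ∀ i b, ∃ r, bimoduleEnd ((Pi.evalAlgHom F B i).comp (p.comp ι)) r (p m₀ i) = b :=
    fun i b => by
      obtain ⟨r, hr⟩ := hcyc (Pi.single i b)
      refine ⟨r, ?_⟩
      have h := map_bimoduleEnd (Pi.evalAlgHom F B i) (p.comp ι) r (p m₀)
      rw [hr] at h
      simpa using h.symm
  -- Upper bound on the corner of `A`: its dimension is `(dim Kε i)²`, and an element of `K` that
  -- vanishes in `B i` is killed by `ε i`.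
  have hlow : ∀ i, Module.finrank F (LinearMap.range (sandwich (ι (ε i)) (ι (ε i)))) ≤
      Module.finrank F (B i) := fun i => by
    rw [hrank]
    refine sq_finrank_le_of_bimodule_cyclic _ _ (fun k hk => ?_) _ (hcyci i)
    have hk' : p (ι k) i = 0 := hk
    apply hq
    rw [LinearMap.mulLeft_apply, map_mul, hε, map_zero]
    funext j
    by_cases hj : j = i
    · subst hj
      simp [hk']
    · simp [hj]
  let corner : ∀ i, nucleus F A →ₗ[F] nucleus F A := fun i =>
    (LinearMap.mulLeft F (ι (ε i))).comp (LinearMap.mulRight F (ι (ε i)))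
  have hcorner : ∀ i x, corner i x = ι (ε i) * (x * ι (ε i)) := fun _ _ => rfl
  have hpcorner : ∀ i x, p (corner i x) i = p x i := fun i x => by
    simp [hcorner, hεp]
  let toB : ∀ i, LinearMap.range (corner i) →ₗ[F] B i := fun i =>
    (LinearMap.proj i).comp (p.toLinearMap.comp (LinearMap.range (corner i)).subtype)
  have htoB : ∀ i, Function.Surjective (toB i) := fun i b => by
    obtain ⟨x, hx⟩ := hp (Pi.single i b)
    exact ⟨⟨corner i x, x, rfl⟩, (hpcorner i x).trans (by rw [hx, Pi.single_eq_same])⟩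
  have hle : ∀ i, Module.finrank F (LinearMap.range (corner i)) ≤
      Module.finrank F (LinearMap.range (sandwich (ι (ε i)) (ι (ε i)))) := fun i => by
    let g : LinearMap.range (corner i) →ₗ[F]
        LinearMap.range (sandwich (ι (ε i)) (ι (ε i))) :=
      ((nucleus F A).toSubmodule.subtype.comp (LinearMap.range (corner i)).subtype).codRestrict _
        (by rintro ⟨_, x, rfl⟩; exact ⟨x, rfl⟩)
    refine LinearMap.finrank_le_finrank_of_injective (f := g) fun x y hxy => ?_
    have h : (g x : A) = g y := congrArg Subtype.val hxy
    exact Subtype.ext (Subtype.ext h)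
  have hge : ∀ i, Module.finrank F (B i) ≤ Module.finrank F (LinearMap.range (corner i)) :=
    fun i => LinearMap.finrank_le_finrank_of_surjective (htoB i)
  -- The corner of the nucleus lies in that of `A` and surjects onto `B i`; with `hlow` the
  -- dimensions are squeezed, so the surjection is an isomorphism.
  have hinj : ∀ i, Function.Injective (toB i) := fun i =>
    (LinearMap.injective_iff_surjective_of_finrank_eq_finrank
      (le_antisymm ((hle i).trans (hlow i)) (hge i))).mpr (htoB i)
  have hzero : ∀ i x, p x i = 0 → corner i x = 0 := fun i x hx => by
    have : (⟨corner i x, x, rfl⟩ : LinearMap.range (corner i)) = 0 :=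
      hinj i (((hpcorner i x).trans hx).trans (map_zero _).symm)
    exact congrArg Subtype.val this
  have hdim : ∀ i, Module.finrank F (LinearMap.range (LinearMap.mulLeft F (ε i))) ^ 2 =
      Module.finrank F (B i) := fun i => by
    rw [sq, ← hrank]
    exact le_antisymm (hlow i) ((hge i).trans (hle i))
  have horth : ∀ i j, ε i * ε j = if i = j then ε i else 0 := fun i j => by
    apply hq
    rw [map_mul, hε, hε]
    split_ifs with h
    · subst h
      rw [hε, ← Pi.single_mul, one_mul]
    · rw [map_zero]
      funext l
      by_cases hl : l = i
      · subst hl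
        simp [h]
      · simp [hl]
  -- The centralizer of the `ε i` is the sum of the nuclear corners; `p` maps it isomorphically onto
  -- the product, and the inverse is the splitting.
  let S : Subalgebra F (nucleus F A) := Subalgebra.centralizer F (Set.range fun i => ι (ε i))
  have hS : ∀ x, x ∈ S ↔ ∀ i, ι (ε i) * x = x * ι (ε i) := fun x => by
    simp [S, Subalgebra.mem_centralizer_iff]
  have hcornerS : ∀ x ∈ S, ∑ i, corner i x = x := fun x hx => by
    conv_rhs => rw [← one_mul x, ← hsum, Finset.sum_mul]
    refine Finset.sum_congr rfl fun i _ => ?_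
    rw [hcorner, ← (hS x).mp hx i, ← mul_assoc, ← map_mul, horth, if_pos rfl]
  have hSmem : ∀ i x, corner i x ∈ S := fun i x => (hS _).mpr fun j => by
    rw [hcorner, ← mul_assoc, ← map_mul, horth, mul_assoc, mul_assoc, ← map_mul, horth]
    split_ifs with h1 h2 h2
    · rw [h1]
    · exact absurd h1.symm h2
    · exact absurd h2.symm h1
    · simp
  have hbij : Function.Bijective (p.comp S.val) := by
    constructor
    · refine (injective_iff_map_eq_zero _).mpr fun x hx => Subtype.ext ?_
      rw [← hcornerS x x.2]
      exact Finset.sum_eq_zero fun i _ => hzero i x (congrFun hx i)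
    · intro b
      obtain ⟨x, rfl⟩ := hp b
      refine ⟨⟨∑ i, corner i x, S.sum_mem fun i _ => hSmem i x⟩, ?_⟩
      change p (∑ i, corner i x) = p x
      rw [map_sum]
      funext j
      rw [Finset.sum_apply, Finset.sum_eq_single j]
      · exact hpcorner j x
      · intro i _ hij
        simp [hcorner, hεp, hij.symm]
      · simp
  let ψ : (∀ i, B i) →ₐ[F] nucleus F A := S.val.comp (AlgEquiv.ofBijective _ hbij).symm.toAlgHom
  have hψ : ∀ i, ψ (Pi.single i 1) = ι (ε i) := fun i => by
    have hεS : ι (ε i) ∈ S := (hS _).mpr fun j => by rw [← map_mul, ← map_mul, mul_comm]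
    have h : (AlgEquiv.ofBijective _ hbij).symm (Pi.single i 1) = ⟨ι (ε i), hεS⟩ := by
      rw [AlgEquiv.symm_apply_eq]
      exact (hεp i).symm
    exact congrArg Subtype.val h
  refine ⟨ψ, fun i j => ?_⟩
  rw [hψ, hψ, hrank, mul_pow, hdim, hdim]

end Splitting

/-! ### Minimally faithful modules over commutative semisimple rings -/

section MinimallyFaithful

variable {R M : Type*} [CommRing R] [IsSemisimpleRing R] [AddCommGroup M] [Module R M]

/-- A faithful module over a commutative semisimple ring contains an element with zero
annihilator. -/
theorem exists_smul_eq_zero_imp [FaithfulSMul R M] : ∃ m : M, ∀ r : R, r • m = 0 → r = 0 := by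
  obtain ⟨_, ⟨m, rfl⟩, hmin⟩ := WellFounded.has_min (wellFounded_lt (α := Submodule R R))
    (Set.range fun m : M => LinearMap.ker (LinearMap.toSpanSingleton R M m)) ⟨_, 0, rfl⟩
  refine ⟨m, ?_⟩
  have hmem : ∀ (r : R) (x : M), r ∈ LinearMap.ker (LinearMap.toSpanSingleton R M x) ↔ r • x = 0 :=
    fun r x => by simp
  obtain ⟨e, he, hspan⟩ := IsSemisimpleRing.ideal_eq_span_idempotent
    (LinearMap.ker (LinearMap.toSpanSingleton R M m))
  have hem : e • m = 0 := (hmem e m).mp (hspan ▸ Ideal.mem_span_singleton_self e)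
  suffices he0 : e = 0 by
    intro r hr
    have h := (hmem r m).mpr hr
    rw [hspan, he0] at h
    simpa using h
  by_contra he0
  obtain ⟨a, ha⟩ : ∃ a : M, e • a ≠ 0 := by
    by_contra! h
    exact he0 (FaithfulSMul.eq_of_smul_eq_smul (α := M) fun a => by rw [h a, zero_smul])
  -- Multiplying by `1 - e` shows that the annihilator of `m + e • a` lies in that of `m`; it is
  -- strictly smaller since it omits `e`. This contradicts the minimal choice of `m`.
  refine hmin _ ⟨m + e • a, rfl⟩ (lt_of_le_of_ne (fun r hr => ?_) fun h => ?_)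
  · have hr' := (hmem _ _).mp hr
    refine (hmem _ _).mpr ?_
    have h1 : (1 - e) • r • (m + e • a) = r • m := by
      have h2 : e • e • a = e • a := by rw [smul_smul, he.eq]
      rw [smul_comm, sub_smul, one_smul, smul_add, hem, h2, zero_add, add_sub_cancel_right]
    rw [← h1, hr', smul_zero]
  · have h1 := (hmem e (m + e • a)).mp (h.symm.le ((hmem e m).mpr hem))
    rw [smul_add, hem, zero_add, smul_smul, he.eq] at h1
    exact ha h1

/-- A minimally faithful module over a commutative semisimple ring is free of rank one. -/
theorem IsMinimallyFaithful.exists_bijective (h : IsMinimallyFaithful R M) :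
    ∃ m : M, Function.Bijective (LinearMap.toSpanSingleton R M m) := by
  have := h.1
  obtain ⟨m, hm⟩ := exists_smul_eq_zero_imp (R := R) (M := M)
  refine ⟨m, (injective_iff_map_eq_zero _).mpr fun r hr => hm r (by simpa using hr), ?_⟩
  rw [← LinearMap.range_eq_top]
  -- The submodule `R m` is itself a faithful section, so it is all of `M`.
  refine (h.2 ⊥ (LinearMap.range (LinearMap.toSpanSingleton R M m)) bot_le ⟨?_⟩).2
  intro r s hrs
  have h1 := hrs (Submodule.Quotient.mk ⟨m, 1, by simp⟩)
  rw [← Submodule.Quotient.mk_smul, ← Submodule.Quotient.mk_smul, Submodule.Quotient.eq] at h1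
  have h2 : r • m - s • m = 0 := h1
  exact sub_eq_zero.mp (hm _ (by rw [sub_smul, h2]))

end MinimallyFaithful

/-! ### The `K`-bimodule structure of `A` and its nucleus -/

section Cyclic

variable {F : Type u} {A : Type v} [Field F] [NonAssocRing A] [Module F A] [IsScalarTower F A A]
  [SMulCommClass F A A] {K : Type v} [CommRing K] [Algebra F K]

theorem coe_bimoduleEnd (ι : K →ₐ[F] nucleus F A) (r : K ⊗[F] K) (x : nucleus F A) :
    ((bimoduleEnd ι r x : nucleus F A) : A) = bimoduleAction ι r x := by
  induction r with
  | zero => simp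
  | add s t hs ht =>
    rw [map_add, map_add, LinearMap.add_apply, LinearMap.add_apply, ← hs, ← ht]
    rfl
  | tmul k k' => rw [bimoduleEnd_tmul, bimoduleAction_tmul]; rfl

/-- If `A` is minimally faithful over `K ⊗ K` for an étale algebra `K` in its nucleus, then `A` is
isomorphic to `K ⊗ K` as a bimodule, and its nucleus is a cyclic bimodule. -/
theorem exists_cyclic_of_isMinimallyFaithful [Algebra.Etale F K] (ι : K →ₐ[F] nucleus F A)
    (h : letI : Module (K ⊗[F] K) A := Module.compHom A (bimoduleAction ι).toRingHom
      IsMinimallyFaithful (K ⊗[F] K) A) :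
    (∃ m₀ : nucleus F A, ∀ x, ∃ r, bimoduleEnd ι r m₀ = x) ∧
      ∀ k k', Module.finrank F (LinearMap.range (sandwich (ι k) (ι k'))) =
        Module.finrank F (LinearMap.range (LinearMap.mulLeft F k)) *
          Module.finrank F (LinearMap.range (LinearMap.mulLeft F k')) := by
  have : Module.Finite F K := Algebra.FormallyUnramified.finite_of_free F K
  have : Algebra.Etale F (K ⊗[F] K) := Algebra.Etale.comp F K (K ⊗[F] K)
  have : IsReduced (K ⊗[F] K) := Algebra.FormallyUnramified.isReduced_of_field F (K ⊗[F] K)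
  have : IsArtinianRing (K ⊗[F] K) := isArtinian_of_tower F inferInstance
  have : IsSemisimpleRing (K ⊗[F] K) := IsArtinianRing.isSemisimpleRing_of_isReduced _
  let _ : Module (K ⊗[F] K) A := Module.compHom A (bimoduleAction ι).toRingHom
  obtain ⟨m, hm⟩ := IsMinimallyFaithful.exists_bijective h
  let T : K ⊗[F] K →ₗ[F] A := (LinearMap.applyₗ m).comp (bimoduleAction ι).toLinearMap
  have hT : Function.Bijective T := hm
  have hTmul : ∀ r s, T (r * s) = bimoduleAction ι r (T s) := fun r s => by
    change bimoduleAction ι (r * s) m = _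
    rw [map_mul]
    rfl
  constructor
  · have hstable : ∀ r (x : nucleus F A), bimoduleAction ι r x ∈ nucleus F A := fun r x =>
      coe_bimoduleEnd ι r x ▸ (bimoduleEnd ι r x).2
    -- Under `A ≅ K ⊗ K` the nucleus becomes an ideal, which semisimplicity makes principal.
    let J : Ideal (K ⊗[F] K) :=
      { carrier := {r | T r ∈ nucleus F A}
        add_mem' := fun {r s} hr hs => by
          simpa only [Set.mem_ofPred_eq, map_add] using add_mem hr hs
        zero_mem' := by simp
        smul_mem' := fun r s hs => by
          simpa only [Set.mem_ofPred_eq, smul_eq_mul, hTmul] using hstable r ⟨_, hs⟩ }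
    obtain ⟨e, -, he⟩ := IsSemisimpleRing.ideal_eq_span_idempotent J
    have heJ : e ∈ J := he ▸ Ideal.mem_span_singleton_self e
    refine ⟨⟨T e, heJ⟩, fun x => ?_⟩
    obtain ⟨r, hr⟩ := hT.2 x
    have hrJ : r ∈ J := by
      change T r ∈ nucleus F A
      exact hr ▸ x.2
    rw [he] at hrJ
    obtain ⟨s, rfl⟩ := Ideal.mem_span_singleton'.mp hrJ
    refine ⟨s, Subtype.ext ?_⟩
    rw [coe_bimoduleEnd, ← hr, hTmul]
  · intro k k'
    -- Transported to `K ⊗ K`, the map `a ↦ k a k'` is the tensor product of two multiplications,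
    -- whose rank is a product.
    have hcomp : (sandwich (ι k) (ι k')).comp T =
        T.comp (TensorProduct.map (LinearMap.mulLeft F k) (LinearMap.mulLeft F k')) := by
      refine LinearMap.ext fun r => ?_
      have h1 : TensorProduct.map (LinearMap.mulLeft F k) (LinearMap.mulLeft F k') r =
          (k ⊗ₜ k') * r := by
        induction r with
        | zero => simp
        | add s t hs ht => rw [map_add, hs, ht, mul_add]
        | tmul s t => simp
      change sandwich (ι k) (ι k') (T r) = T (TensorProduct.map _ _ r)
      rw [h1, hTmul, bimoduleAction_tmul,
        sandwich_apply, nucleus_mul_assoc_left]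
    rw [← finrank_range_tensorMap, ← LinearMap.range_comp_of_range_eq_top _
      (LinearMap.range_eq_top.mpr hT.2), hcomp, LinearMap.range_comp]
    exact (Submodule.equivMapOfInjective T hT.1 _).finrank_eq.symm

end Cyclic

/-! ### Peirce components inside matrix blocks -/

section MatrixBlocks

variable {F : Type u} {A : Type v} {D : Type w} [Field F] [NonAssocRing A] [Module F A]
  [IsScalarTower F A A] [SMulCommClass F A A] [DivisionRing D] [Algebra F D]
  {I : Type*} [DecidableEq I] {k : I → ℕ}

/-- The image of a matrix unit of the `i`-th block. -/
def blockUnit (ψ : (∀ i, Matrix (Fin (k i)) (Fin (k i)) D) →ₐ[F] nucleus F A) (i : I)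
    (a b : Fin (k i)) : nucleus F A := ψ (Pi.single i (Matrix.single a b 1))

variable (ψ : (∀ i, Matrix (Fin (k i)) (Fin (k i)) D) →ₐ[F] nucleus F A)

theorem blockUnit_mul (i : I) (a b c d : Fin (k i)) :
    blockUnit ψ i a b * blockUnit ψ i c d = if b = c then blockUnit ψ i a d else 0 := by
  rw [blockUnit, blockUnit, ← map_mul, ← Pi.single_mul]
  split_ifs with h
  · rw [h, Matrix.single_mul_single_same, mul_one, blockUnit]
  · rw [Matrix.single_mul_single_of_ne _ _ _ _ h, Pi.single_zero, map_zero]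

theorem blockUnit_mul_of_ne {i j : I} (hij : i ≠ j) (a b : Fin (k i)) (c d : Fin (k j)) :
    blockUnit ψ i a b * blockUnit ψ j c d = 0 := by
  rw [blockUnit, blockUnit, ← map_mul, ← map_zero ψ]
  congr 1
  funext l
  by_cases hl : l = i
  · subst hl
    simp [hij]
  · simp [hl]

theorem sum_blockUnit (i : I) : ∑ a, blockUnit ψ i a a = ψ (Pi.single i 1) := by
  simp only [blockUnit]
  rw [← map_sum, ← Matrix.sum_single_one]
  congr 1
  exact (map_sum (AddMonoidHom.single (fun i => Matrix (Fin (k i)) (Fin (k i)) D) i) _ _).symm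

theorem completeOrthogonalIdempotents_blockUnit [Fintype I] :
    CompleteOrthogonalIdempotents fun s : Σ i, Fin (k i) => blockUnit ψ s.1 s.2 s.2 where
  idem := fun ⟨i, a⟩ => by
    rw [IsIdempotentElem, blockUnit_mul, if_pos rfl]
  ortho := by
    rintro ⟨i, a⟩ ⟨j, b⟩ h
    by_cases hij : i = j
    · subst hij
      have hab : a ≠ b := fun h' => h (by rw [h'])
      exact (blockUnit_mul ψ i a a b b).trans (if_neg hab)
    · exact blockUnit_mul_of_ne ψ hij a a b b
  complete := by
    rw [Fintype.sum_sigma]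
    simp only [sum_blockUnit]
    rw [← map_sum, ← map_one ψ]
    congr 1
    exact Finset.univ_sum_single 1

/-- Left and right matrix units carry one Peirce component to each of the `k i * k j` positions of
the block; the opposite units recover each summand, so the copies are independent. -/
theorem mul_finrank_le_finrank_block [FiniteDimensional F A] (i j : I) (a : Fin (k i))
    (b : Fin (k j)) :
    k i * k j * Module.finrank F
        (LinearMap.range (sandwich (blockUnit ψ i a a) (blockUnit ψ j b b))) ≤
      Module.finrank F
        (LinearMap.range (sandwich (ψ (Pi.single i 1)) (ψ (Pi.single j 1)))) := by
  set X := LinearMap.range (sandwich (blockUnit ψ i a a) (blockUnit ψ j b b))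
  have hX : ∀ x : X, sandwich (blockUnit ψ i a a) (blockUnit ψ j b b) x = x := by
    rintro ⟨_, y, rfl⟩
    rw [sandwich_sandwich, blockUnit_mul, blockUnit_mul, if_pos rfl, if_pos rfl]
  let G : (Fin (k i) × Fin (k j) → X) →ₗ[F] A :=
    ∑ s, (sandwich (blockUnit ψ i s.1 a) (blockUnit ψ j b s.2)).comp
      (X.subtype.comp (LinearMap.proj s))
  have hG : ∀ x, G x = ∑ s, sandwich (blockUnit ψ i s.1 a) (blockUnit ψ j b s.2) (x s) :=
    fun x => by simp [G, LinearMap.sum_apply]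
  have hGinj : Function.Injective G := (injective_iff_map_eq_zero G).mpr fun x hx => by
    funext t
    have h := congrArg (sandwich (blockUnit ψ i a t.1) (blockUnit ψ j t.2 b)) hx
    rw [hG, map_sum, Finset.sum_eq_single t, sandwich_sandwich, blockUnit_mul, blockUnit_mul,
      if_pos rfl, if_pos rfl, hX, map_zero] at h
    · exact Subtype.ext h
    · intro s _ hs
      rw [sandwich_sandwich, blockUnit_mul, blockUnit_mul]
      by_cases h1 : t.1 = s.1
      · have h2 : s.2 ≠ t.2 := fun h2 => hs (Prod.ext h1.symm h2)
        simp [h2, sandwich]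
      · simp [h1, sandwich]
    · simp
  have hle : LinearMap.range G ≤
      LinearMap.range (sandwich (ψ (Pi.single i 1)) (ψ (Pi.single j 1))) := by
    rintro _ ⟨x, rfl⟩
    refine ⟨G x, ?_⟩
    rw [hG, map_sum]
    refine Finset.sum_congr rfl fun s _ => ?_
    rw [sandwich_sandwich, ← sum_blockUnit, ← sum_blockUnit, Finset.sum_mul, Finset.mul_sum]
    simp [blockUnit_mul]
  have h := Submodule.finrank_mono hle
  rwa [LinearMap.finrank_range_of_inj hGinj, Module.finrank_pi_fintype, Finset.sum_const,
    Finset.card_univ, Fintype.card_prod, Fintype.card_fin, Fintype.card_fin, smul_eq_mul] at h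

/-- Matrix units make all diagonal Peirce projections of a block factor through any one of them, so
if one vanishes the whole block does. -/
theorem sandwich_blockUnit_ne_zero (i j : I) (a : Fin (k i)) (b : Fin (k j))
    (h : sandwich (ψ (Pi.single i 1)) (ψ (Pi.single j 1)) ≠ 0) :
    sandwich (blockUnit ψ i a a) (blockUnit ψ j b b) ≠ 0 := by
  intro h0
  apply h
  rw [← sum_blockUnit, ← sum_blockUnit, sandwich_sum_sum]
  refine Finset.sum_eq_zero fun a' _ => Finset.sum_eq_zero fun b' _ => ?_
  have h1 : sandwich (blockUnit ψ i a' a') (blockUnit ψ j b' b') =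
      sandwich (blockUnit ψ i a' a) (blockUnit ψ j b b') *
        sandwich (blockUnit ψ i a a) (blockUnit ψ j b b) *
          sandwich (blockUnit ψ i a a') (blockUnit ψ j b' b) := by
    simp [sandwich_mul, blockUnit_mul]
  rw [h1, h0, mul_zero, zero_mul]

/-- An algebra whose nucleus contains a product of matrix algebras over a central division
algebra `D`, with Peirce components of the expected dimensions, is the tensor product of `D` and a
skew matrix algebra. -/
theorem exists_equiv_tensor_skewMatrix_of_blocks [FiniteDimensional F A] [FiniteDimensional F D]
    [Algebra.IsCentral F D] [Fintype I] [Nonempty I] (hk : ∀ i, k i ≠ 0)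
    (hψ : ∀ i j,
      Module.finrank F (LinearMap.range (sandwich (ψ (Pi.single i 1)) (ψ (Pi.single j 1)))) ^ 2 =
        Module.finrank F (Matrix (Fin (k i)) (Fin (k i)) D) *
          Module.finrank F (Matrix (Fin (k j)) (Fin (k j)) D)) :
    ∃ (n : ℕ) (_ : 1 ≤ n) (c : ReducedSkewSet F n) (e : A ≃ₗ[F] D ⊗[F] SkewMatrix c),
      e 1 = 1 ∧ ∀ x y : A, e (x * y) = e x * e y := by
  have hD : 0 < Module.finrank F D := Module.finrank_pos
  have hψ' : ∀ i j,
      Module.finrank F (LinearMap.range (sandwich (ψ (Pi.single i 1)) (ψ (Pi.single j 1)))) =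
        k i * k j * Module.finrank F D := fun i j => by
    refine Nat.pow_left_injective two_ne_zero ((hψ i j).trans ?_)
    simp only [Module.finrank_matrix, Fintype.card_fin]
    ring
  have hpos : ∀ i, 0 < k i := fun i => Nat.pos_of_ne_zero (hk i)
  let P := Σ i, Fin (k i)
  let s : Fin (Fintype.card P) ≃ P := (Fintype.equivFin P).symm
  have hP : Nonempty P := ‹Nonempty I›.map fun i => ⟨i, ⟨0, hpos i⟩⟩
  -- `D` sits diagonally, as scalar matrices in every block at once, so it commutes with the
  -- diagonal matrix units.
  let δ : D →ₐ[F] nucleus F A :=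
    ψ.comp (AlgHom.pi fun i => Matrix.scalarAlgHom (Fin (k i)) F)
  refine ⟨Fintype.card P, Fintype.card_pos, exists_equiv_tensor_skewMatrix δ
    (fun p => blockUnit ψ (s p).1 (s p).2 (s p).2)
    ((CompleteOrthogonalIdempotents.equiv s).mpr (completeOrthogonalIdempotents_blockUnit ψ))
    (fun d p => ?_) (fun p q => ?_) fun p q => ?_⟩
  · refine Commute.map (f := ψ) ?_
    funext i
    by_cases hi : i = (s p).1
    · generalize s p = t at hi
      subst hi
      ext x y
      simp [Matrix.diagonal_mul, Matrix.mul_diagonal, Matrix.single_apply]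
    · simp [hi]
  · refine sandwich_blockUnit_ne_zero ψ _ _ _ _ fun h => ?_
    have h1 := hψ' (s p).1 (s q).1
    rw [h, LinearMap.range_zero, finrank_bot] at h1
    have := Nat.mul_pos (Nat.mul_pos (hpos (s p).1) (hpos (s q).1)) hD
    omega
  · have h := mul_finrank_le_finrank_block ψ (s p).1 (s q).1 (s p).2 (s q).2
    rw [hψ'] at h
    exact Nat.le_of_mul_le_mul_left h (Nat.mul_pos (hpos _) (hpos _))

end MatrixBlocks

/-! ### Uniqueness of the underlying division algebra -/

section DivisionAlgebras

variable {F B D D' : Type*} [Field F] [Ring B] [Algebra F B] [DivisionRing D] [Algebra F D]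
  [DivisionRing D'] [Algebra F D']

/-- Two division algebras that are corners of the same simple ring are isomorphic. -/
theorem nonempty_algEquiv_of_corners [IsSimpleRing B] (s : D →ₙₐ[F] B) (s' : D' →ₙₐ[F] B)
    (hs : Function.Injective s) (hs' : Function.Injective s')
    (hcorner : ∀ b, ∃ d, s d = s 1 * b * s 1) (hcorner' : ∀ b, ∃ d, s' d = s' 1 * b * s' 1) :
    Nonempty (D ≃ₐ[F] D') := by
  have hone : ∀ d, s 1 * s d = s d := fun d => by rw [← map_mul, one_mul]
  have hone' : ∀ d, s' 1 * s' d = s' d := fun d => by rw [← map_mul, one_mul]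
  have hone'_right : ∀ d, s' d * s' 1 = s' d := fun d => by rw [← map_mul, mul_one]
  have h1 : s 1 ≠ 0 := fun h => one_ne_zero (hs (h.trans (map_zero s).symm))
  have h1' : s' 1 ≠ 0 := fun h => one_ne_zero (hs' (h.trans (map_zero s').symm))
  -- Otherwise `s 1` would lie in the two-sided ideal of all `b` with `s' 1 * B * b * B * s' 1 = 0`,
  -- which is proper.
  obtain ⟨x, y, hxy⟩ : ∃ x y, s' 1 * x * s 1 * y * s' 1 ≠ 0 := by
    by_contra! h
    let J : TwoSidedIdeal B := .mk' {b | ∀ x y, s' 1 * x * b * y * s' 1 = 0} (by simp)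
      (fun {a b} ha hb x y => by rw [mul_add, add_mul, add_mul, ha, hb, add_zero])
      (fun {a} ha x y => by rw [mul_neg, neg_mul, neg_mul, ha, neg_zero])
      (fun {a b} hb x y => by rw [← mul_assoc, mul_assoc (s' 1) x a, hb])
      (fun {a b} ha x y => by rw [← mul_assoc, mul_assoc _ b y, ha])
    have hJ : (1 : B) ∈ J := IsSimpleRing.one_mem_of_ne_zero_mem J h1 (by simpa [J] using h)
    have hJ' : ∀ x y, s' 1 * x * 1 * y * s' 1 = 0 := by simpa [J] using hJ
    exact h1' (by simpa [hone'] using hJ' 1 1)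
  obtain ⟨d₀, hd₀⟩ := hcorner' (x * s 1 * y)
  have hd₀0 : d₀ ≠ 0 := by
    rintro rfl
    rw [map_zero] at hd₀
    exact hxy (by rw [mul_assoc (s' 1), mul_assoc (s' 1), ← hd₀])
  -- Put `e = s 1` and `e' = s' 1`. Then `Y ∈ e'Be` and `X ∈ eBe'` satisfy `Y X = e'`, and `X Y = e`
  -- as a nonzero idempotent of the division ring `eBe`. The isomorphism is `d ↦ Y d X`.
  set Y := s' d₀⁻¹ * x * s 1 with hY
  set X := s 1 * y * s' 1 with hX
  have hYX : Y * X = s' 1 := by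
    have h : Y * X = s' d₀⁻¹ * (s' 1 * (x * s 1 * y) * s' 1) := by
      have h2 : s' d₀⁻¹ = s' d₀⁻¹ * s' 1 := (hone'_right _).symm
      calc Y * X = s' d₀⁻¹ * x * (s 1 * s 1) * y * s' 1 := by simp only [hY, hX, mul_assoc]
        _ = s' d₀⁻¹ * s' 1 * x * s 1 * y * s' 1 := by rw [hone, ← h2]
        _ = _ := by simp only [mul_assoc]
    rw [h, ← hd₀, ← map_mul, inv_mul_cancel₀ hd₀0]
  have hsX : s 1 * X = X := by rw [hX, ← mul_assoc, ← mul_assoc, hone]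
  have hXs : X * s' 1 = X := by rw [hX, mul_assoc, hone']
  have hYs : Y * s 1 = Y := by rw [hY, mul_assoc, hone]
  have hsY : s' 1 * Y = Y := by rw [hY, ← mul_assoc, ← mul_assoc, hone']
  have hXY : X * Y = s 1 := by
    obtain ⟨d, hd⟩ := hcorner (X * Y)
    rw [← mul_assoc, hsX, mul_assoc, hYs] at hd
    have hidem : d * d = d := hs (by
      rw [map_mul, hd, mul_assoc, ← mul_assoc Y, hYX, hsY])
    have hd0 : d ≠ 0 := by
      rintro rfl
      rw [map_zero] at hd
      apply h1'
      rw [← hone', ← hYX, mul_assoc, ← mul_assoc X, ← hd, zero_mul, mul_zero]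
    rw [← hd, mul_left_cancel₀ hd0 (hidem.trans (mul_one d).symm)]
  choose t ht using fun d => hcorner' (Y * s d * X)
  have ht : ∀ d, s' (t d) = Y * s d * X := fun d => by
    calc s' (t d) = (s' 1 * Y) * s d * (X * s' 1) := by rw [ht]; simp only [mul_assoc]
      _ = _ := by rw [hsY, hXs]
  have hmul : ∀ a b, t (a * b) = t a * t b := fun a b => hs' <| by
    rw [map_mul, ht, ht, ht, map_mul]
    calc Y * (s a * s b) * X = Y * s a * (s 1 * s b) * X := by rw [hone]; simp only [mul_assoc]
      _ = _ := by rw [← hXY]; simp only [mul_assoc]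
  have htone : t 1 = 1 := hs' (by rw [ht, hYs, hYX])
  let T : D →ₐ[F] D' := AlgHom.ofLinearMap
    { toFun := t
      map_add' := fun a b => hs' (by rw [map_add, ht, ht, ht, map_add, mul_add, add_mul])
      map_smul' := fun r a => hs' (by
        rw [RingHom.id_apply, map_smul, ht, ht, map_smul, mul_smul_comm, smul_mul_assoc]) }
    htone hmul
  refine ⟨AlgEquiv.ofBijective T ⟨T.toRingHom.injective, fun d' => ?_⟩⟩
  obtain ⟨d, hd⟩ := hcorner (X * s' d' * Y)
  refine ⟨d, hs' ?_⟩
  change s' (t d) = s' d'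
  rw [ht, hd]
  calc Y * (s 1 * (X * s' d' * Y) * s 1) * X = (Y * s 1) * X * s' d' * (Y * (s 1 * X)) := by
        simp only [mul_assoc]
    _ = s' d' := by rw [hYs, hsX, hYX, hone', hone'_right]

/-- The embedding of a ring into the upper left corner of a matrix ring. -/
def cornerEmbedding (F D : Type*) [CommSemiring F] [Semiring D] [Algebra F D] {n : ℕ} [NeZero n] :
    D →ₙₐ[F] Matrix (Fin n) (Fin n) D where
  toFun d := Matrix.single 0 0 d
  map_smul' r d := by simp [Matrix.smul_single]
  map_zero' := Matrix.single_zero 0 0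
  map_add' := Matrix.single_add 0 0
  map_mul' a b := by simp

theorem cornerEmbedding_apply {n : ℕ} [NeZero n] (d : D) :
    cornerEmbedding F D (n := n) d = Matrix.single 0 0 d := rfl

theorem cornerEmbedding_injective {n : ℕ} [NeZero n] :
    Function.Injective (cornerEmbedding F D (n := n)) := fun a b h => by
  simpa [cornerEmbedding_apply] using congrFun (congrFun h 0) 0

theorem exists_cornerEmbedding_eq {n : ℕ} [NeZero n] (M : Matrix (Fin n) (Fin n) D) :
    ∃ d, cornerEmbedding F D d = cornerEmbedding F D 1 * M * cornerEmbedding F D 1 :=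
  ⟨M 0 0, by simp [cornerEmbedding_apply, Matrix.single_mul_mul_single]⟩

/-- The division algebra of a matrix algebra is unique. -/
theorem nonempty_algEquiv_of_matrix {m n : ℕ} (hm : m ≠ 0) (hn : n ≠ 0)
    (e : Matrix (Fin m) (Fin m) D ≃ₐ[F] Matrix (Fin n) (Fin n) D') : Nonempty (D ≃ₐ[F] D') := by
  have : NeZero m := ⟨hm⟩
  have : NeZero n := ⟨hn⟩
  refine nonempty_algEquiv_of_corners (B := Matrix (Fin n) (Fin n) D')
    ((NonUnitalAlgHomClass.toNonUnitalAlgHom e.toAlgHom).comp (cornerEmbedding F D))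
    (cornerEmbedding F D')
    (e.injective.comp (cornerEmbedding_injective (F := F))) cornerEmbedding_injective (fun b => ?_)
    exists_cornerEmbedding_eq
  obtain ⟨d, hd⟩ := exists_cornerEmbedding_eq (F := F) (e.symm b)
  have h := congrArg e hd
  rw [map_mul, map_mul, e.apply_symm_apply] at h
  exact ⟨d, h⟩

theorem isCentral_of_algEquiv {C : Type*} [Ring C] [Algebra F C] [h : Algebra.IsCentral F B]
    (e : B ≃ₐ[F] C) : Algebra.IsCentral F C where
  out x hx := by
    obtain ⟨r, hr⟩ := h.out ((MulEquivClass.apply_mem_center_iff e.symm).mpr hx)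
    exact ⟨r, by simpa [Algebra.ofId] using congrArg e hr⟩

theorem isCentral_of_matrix {n : ℕ} (hn : n ≠ 0)
    (h : Algebra.IsCentral F (Matrix (Fin n) (Fin n) D)) : Algebra.IsCentral F D where
  out z hz := by
    have : NeZero n := ⟨hn⟩
    have hc : Matrix.scalar (Fin n) z ∈ Subalgebra.center F (Matrix (Fin n) (Fin n) D) := by
      rw [Matrix.subalgebraCenter_eq_scalarAlgHom_map]
      exact ⟨z, hz, rfl⟩
    obtain ⟨r, hr⟩ := (Algebra.IsCentral.mem_center_iff F).mp hc
    refine Algebra.mem_bot.mpr ⟨r, ?_⟩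
    simpa [Matrix.algebraMap_matrix_apply] using (congrFun (congrFun hr 0) 0).symm

theorem finiteDimensional_of_matrix {n : ℕ} (hn : n ≠ 0)
    [FiniteDimensional F (Matrix (Fin n) (Fin n) D)] : FiniteDimensional F D := by
  have : NeZero n := ⟨hn⟩
  exact FiniteDimensional.of_injective (Matrix.scalarAlgHom (α := D) (Fin n) F).toLinearMap
    fun a b h => Matrix.scalar_inj.mp h

end DivisionAlgebras

/-! ### Atoms, and assembly of the two assertions -/

section Atoms

variable {F : Type u} {A : Type v} [Field F] [NonAssocRing A] [Module F A] [IsScalarTower F A A]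
  [SMulCommClass F A A]

theorem finiteDimensional_semisimpleQuotient [FiniteDimensional F A] :
    FiniteDimensional F (SemisimpleQuotient F A) := by
  have : FiniteDimensional F (nucleus F A) :=
    inferInstanceAs (FiniteDimensional F (nucleus F A).toSubmodule)
  exact FiniteDimensional.of_surjective
    (Ideal.Quotient.mkₐ F (Ring.jacobson (nucleus F A))).toLinearMap
    (Ideal.Quotient.mkₐ_surjective F _)

theorem IsAtomOf.finiteDimensional [FiniteDimensional F A] {S : Type v} [Ring S] [Algebra F S]
    (hS : IsAtomOf F A S) : FiniteDimensional F S := by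
  have := finiteDimensional_semisimpleQuotient (F := F) (A := A)
  obtain ⟨-, T, _, _, ⟨e⟩⟩ := hS
  exact FiniteDimensional.of_surjective ((LinearMap.fst F S T).comp e.toLinearMap)
    (Prod.fst_surjective.comp e.surjective)

theorem isAtomOf_of_algEquiv_pi {I : Type} [DecidableEq I] {B : I → Type v} [∀ i, Ring (B i)]
    [∀ i, Algebra F (B i)] (e : SemisimpleQuotient F A ≃ₐ[F] ∀ i, B i) (i : I)
    [IsSimpleRing (B i)] : IsAtomOf F A (B i) := by
  let g : (∀ j, B j) →ₐ[F] B i × ∀ j : {j // j ≠ i}, B j :=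
    (Pi.evalAlgHom F B i).prod (AlgHom.pi fun j => Pi.evalAlgHom F B j)
  have hg : Function.Bijective g := by
    constructor
    · intro x y hxy
      funext j
      by_cases hj : j = i
      · subst hj
        exact congrArg Prod.fst hxy
      · exact congrFun (congrArg Prod.snd hxy) ⟨j, hj⟩
    · rintro ⟨x, y⟩
      refine ⟨fun j => if hj : j = i then hj ▸ x else y ⟨j, hj⟩, Prod.ext ?_ ?_⟩
      · simp [g]
      · funext j
        simp [g, j.2]
  exact ⟨inferInstance, _, inferInstance, inferInstance, ⟨e.trans (AlgEquiv.ofBijective g hg)⟩⟩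

/-- The decomposition of the semisimple quotient of the nucleus into atoms. -/
theorem exists_algEquiv_pi_atoms [FiniteDimensional F A] [Nontrivial A] :
    ∃ (n : ℕ) (_ : n ≠ 0) (D : Fin n → Type v) (d : Fin n → ℕ) (_ : ∀ i, DivisionRing (D i))
      (_ : ∀ i, Algebra F (D i)) (_ : ∀ i, d i ≠ 0),
      Nonempty (SemisimpleQuotient F A ≃ₐ[F] ∀ i, Matrix (Fin (d i)) (Fin (d i)) (D i)) ∧
        ∀ i, IsAtomOf F A (Matrix (Fin (d i)) (Fin (d i)) (D i)) := by
  have : FiniteDimensional F (nucleus F A) :=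
    inferInstanceAs (FiniteDimensional F (nucleus F A).toSubmodule)
  have : IsArtinianRing (nucleus F A) := isArtinian_of_tower F inferInstance
  have : Nontrivial (nucleus F A) := ⟨0, 1, fun h => zero_ne_one (congrArg Subtype.val h)⟩
  have : Nontrivial (SemisimpleQuotient F A) :=
    Ideal.Quotient.nontrivial_iff.mpr (Ring.jacobson_lt_top _).ne
  obtain ⟨n, D, d, _, _, hd, ⟨e⟩⟩ :=
    IsSemisimpleRing.exists_algEquiv_pi_matrix_divisionRing F (SemisimpleQuotient F A)
  refine ⟨n, ?_, D, d, inferInstance, inferInstance, fun i => (hd i).out, ⟨e⟩,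
    fun i => isAtomOf_of_algEquiv_pi e i⟩
  rintro rfl
  exact not_subsingleton _ e.toEquiv.subsingleton

/-- Brauer equivalence gives isomorphic matrix algebras over `S` and `S'`; flattening the nested
matrices makes them matrix algebras over `D` and `D'`. -/
theorem IsHomogeneous.nonempty_algEquiv_of_isAtomOf (hA : IsHomogeneous F A) {S S' : Type v}
    [Ring S] [Algebra F S] [Ring S'] [Algebra F S'] (hS : IsAtomOf F A S) (hS' : IsAtomOf F A S')
    {D D' : Type v} [DivisionRing D] [Algebra F D] [DivisionRing D'] [Algebra F D'] {k k' : ℕ}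
    (hk : k ≠ 0) (hk' : k' ≠ 0) (e : S ≃ₐ[F] Matrix (Fin k) (Fin k) D)
    (e' : S' ≃ₐ[F] Matrix (Fin k') (Fin k') D') : Nonempty (D ≃ₐ[F] D') := by
  have := hA.1.1.1
  have := hS.1
  have := hS'.1
  have := hS.finiteDimensional
  have := hS'.finiteDimensional
  have := hA.1.2 S hS
  have := hA.1.2 S' hS'
  obtain ⟨n, n', hn, hn', ⟨b⟩⟩ := hA.2 ⟨.of F S⟩ ⟨.of F S'⟩ hS hS'
  have b : Matrix (Fin n) (Fin n) S ≃ₐ[F] Matrix (Fin n') (Fin n') S' := b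
  have c : Matrix (Fin (n * k)) (Fin (n * k)) D ≃ₐ[F] Matrix (Fin (n' * k')) (Fin (n' * k')) D' :=
    (Matrix.reindexAlgEquiv F D finProdFinEquiv).symm.trans <|
      (Matrix.compAlgEquiv _ _ _ F).symm.trans <| e.mapMatrix.symm.trans <| b.trans <|
      e'.mapMatrix.trans <| (Matrix.compAlgEquiv _ _ _ F).trans <|
      Matrix.reindexAlgEquiv F D' finProdFinEquiv
  exact nonempty_algEquiv_of_matrix (Nat.mul_ne_zero hn hk) (Nat.mul_ne_zero hn' hk') c

theorem IsHomogeneous.exists_underlyingDivisionAlgebra (hA : IsHomogeneous F A) :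
    ∃ (D : Type v) (_ : DivisionRing D) (_ : Algebra F D),
      FiniteDimensional F D ∧ Algebra.IsCentral F D ∧ IsUnderlyingDivisionAlgebra F A D := by
  have := hA.1.1.1
  have := hA.1.1.2.1.1
  obtain ⟨n, hn, D, d, _, _, hd, -, hat⟩ := exists_algEquiv_pi_atoms (F := F) (A := A)
  let i : Fin n := ⟨0, Nat.pos_of_ne_zero hn⟩
  have := (hat i).finiteDimensional
  refine ⟨D i, inferInstance, inferInstance, finiteDimensional_of_matrix (hd i),
    isCentral_of_matrix (hd i) (hA.1.2 _ (hat i)), fun S _ _ hS => ?_⟩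
  have := hS.1
  have := hS.finiteDimensional
  have : IsArtinianRing S := isArtinian_of_tower F inferInstance
  obtain ⟨k, hk, D', _, _, ⟨e⟩⟩ := IsSimpleRing.exists_algEquiv_matrix_divisionRing F S
  obtain ⟨t⟩ := hA.nonempty_algEquiv_of_isAtomOf hS (hat i) hk.out (hd i) e AlgEquiv.refl
  exact ⟨k, hk.out, ⟨e.trans t.mapMatrix⟩⟩

theorem IsSemicentral.exists_equiv_tensor_skewMatrix (hA : IsSemicentral F A) (D : Type w)
    [DivisionRing D] [Algebra F D] (hD : IsUnderlyingDivisionAlgebra F A D) :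
    ∃ (n : ℕ) (_ : 1 ≤ n) (c : ReducedSkewSet F n) (e : A ≃ₗ[F] D ⊗[F] SkewMatrix c),
      e 1 = 1 ∧ ∀ x y : A, e (x * y) = e x * e y := by
  obtain ⟨⟨_, ⟨_, -⟩, K, _, _, ι, _, hι, hmin⟩, hcent⟩ := hA
  obtain ⟨⟨m₀, hm₀⟩, hrank⟩ := exists_cyclic_of_isMinimallyFaithful ι hmin
  have : IsReduced K := Algebra.FormallyUnramified.isReduced_of_field F K
  obtain ⟨n, hn, E, d, _, _, hd, ⟨e⟩, hat⟩ := exists_algEquiv_pi_atoms (F := F) (A := A)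
  choose k hk t using fun i => hD _ (hat i)
  have hfd := fun i => (hat i).finiteDimensional
  have : ∀ i, FiniteDimensional F (Matrix (Fin (k i)) (Fin (k i)) D) := fun i =>
    Module.Finite.equiv (t i).some.toLinearEquiv
  have : ∀ i, Algebra.IsCentral F (Matrix (Fin (k i)) (Fin (k i)) D) := fun i =>
    have := hcent _ (hat i)
    isCentral_of_algEquiv (t i).some
  have : ∀ i, NeZero (k i) := fun i => ⟨hk i⟩
  let i₀ : Fin n := ⟨0, Nat.pos_of_ne_zero hn⟩
  have : Nonempty (Fin n) := ⟨i₀⟩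
  have : FiniteDimensional F D := finiteDimensional_of_matrix (hk i₀)
  have : Algebra.IsCentral F D := isCentral_of_matrix (hk i₀) inferInstance
  have : FiniteDimensional F (nucleus F A) :=
    inferInstanceAs (FiniteDimensional F (nucleus F A).toSubmodule)
  have : IsArtinianRing (nucleus F A) := isArtinian_of_tower F inferInstance
  let e' := e.trans (AlgEquiv.piCongrRight fun i => (t i).some)
  obtain ⟨ψ, hψ⟩ := exists_splitting ι hι m₀ hm₀ hrank
    (e'.toAlgHom.comp (Ideal.Quotient.mkₐ F (Ring.jacobson (nucleus F A))))
    (e'.surjective.comp (Ideal.Quotient.mkₐ_surjective F _)) fun x hx => by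
      have hx0 : Ideal.Quotient.mk (Ring.jacobson (nucleus F A)) x = 0 :=
        e'.injective (Eq.trans hx (map_zero e').symm)
      -- The kernel is the Jacobson radical, which is nilpotent because the nucleus is Artinian.
      obtain ⟨N, hN⟩ := IsSemiprimaryRing.isNilpotent (R := nucleus F A)
      refine ⟨N, ?_⟩
      have := Ideal.pow_mem_pow (Ideal.Quotient.eq_zero_iff_mem.mp hx0) N
      rwa [hN] at this
  exact exists_equiv_tensor_skewMatrix_of_blocks ψ hk hψ

end Atoms

end Semiassociative

theorem mainTheorem10 {F : Type u} {A : Type v} [Field F] [NonAssocRing A] [Module F A]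
    [IsScalarTower F A A] [SMulCommClass F A A] (hA : Semiassociative.IsHomogeneous F A) :
    (∃ (D : Type v) (_ : DivisionRing D) (_ : Algebra F D),
      FiniteDimensional F D ∧ Algebra.IsCentral F D ∧
        Semiassociative.IsUnderlyingDivisionAlgebra F A D) ∧
    ∀ (D : Type w) [DivisionRing D] [Algebra F D],
      Semiassociative.IsUnderlyingDivisionAlgebra F A D →
        ∃ (n : ℕ) (_ : 1 ≤ n) (c : Semiassociative.ReducedSkewSet F n)
          (e : A ≃ₗ[F] D ⊗[F] Semiassociative.SkewMatrix c),
          e 1 = 1 ∧ ∀ x y : A, e (x * y) = e x * e y :=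
  ⟨hA.exists_underlyingDivisionAlgebra, fun D _ _ hD => hA.1.exists_equiv_tensor_skewMatrix D hD⟩
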